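/- Let $f:[0,\infty)\times\mathbb N_0\to[0,\infty)$ satisfy the contractive condition $$|f(\lambda,y)-f(\lambda',y')|\le\kappa_1|\lambda-\lambda'|+\kappa_2|y-y'|\qquad\text{for all }\lambda,\lambda'\ge 0,\ y,y'\in\mathbb N_0,$$ where $\kappa_1,\kappa_2\ge 0$ are constants with $\kappa:=\kappa_1+\kappa_2<1$. Let $((N_t,\lambda_t))_{t\in\mathbb Z}$ be a strictly stationary process with values in $\mathbb N_0\times[0,\infty)$ on a probability space $(\Omega,\mathcal A,P)$ such that, for every $t\in\mathbb Z$, the conditional distribution of $N_t$ given $\sigma(N_s,\lambda_s:s\le t-1)$ is Poisson with parameter $\lambda_t$ (the Poisson distribution with parameter $0$ being the point mass at $0$), and $\lambda_t=f(\lambda_{t-1},N_{t-1})$ almost surely. For $n\ge 1$ let $$\beta(n)=E\Big[\sup_{A\in\sigma(N_n,N_{n+1},\dots)}\big|P(A\mid\sigma(N_0,N_{-1},\dots))-P(A)\big|\Big]$$ be the coefficients of absolute regularity of $(N_t)_{t\in\mathbb Z}$, where the conditional probabilities are taken from a regular conditional distribution of $(N_n,N_{n+1},\dots)$ given $(N_0,N_{-1},\dots)$.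 Then: (i) The count process $(N_t)_{t\in\mathbb Z}$ is absolutely regular, that is, $\beta(n)\to0$ as $n\to\infty$; moreover $E\lambda_1<\infty$ and $$\beta(n)\le \frac{2\,E\lambda_1\,\kappa^{n-1}}{1-\kappa_1}\qquad\text{for all }n\ge1$$ (with $0^0=1$). (ii) There is a measurable function $g:\mathbb N_0^{\infty}\to[0,\infty)$, the same for all $t$, such that for every $t\in\mathbb Z$, $\lambda_t=g(N_{t-1},N_{t-2},\dots)$ almost surely. (iii) The bivariate process $((N_t,\lambda_t))_{t\in\mathbb Z}$ is ergodic, that is, the shift on $(\mathbb N_0\times[0,\infty))^{\mathbb Z}$ is ergodic with respect to the law of the process. (iv) $E\lambda_1^2<\infty$. -/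

import Mathlib

open MeasureTheory ProbabilityTheory Filter Topology
open scoped NNReal ENNReal

noncomputable section

/-- The contractive condition on the intensity function `f : [0,∞) × ℕ₀ → [0,∞)`. -/
structure IsContractive (f : ℝ≥0 → ℕ → ℝ≥0) (κ₁ κ₂ : ℝ) : Prop where
  nonneg_fst : 0 ≤ κ₁
  nonneg_snd : 0 ≤ κ₂
  sum_lt_one : κ₁ + κ₂ < 1
  bound : ∀ (l l' : ℝ≥0) (y y' : ℕ),
    |(f l y : ℝ) - (f l' y' : ℝ)| ≤ κ₁ * |(l : ℝ) - (l' : ℝ)| + κ₂ * |(y : ℝ) - (y' : ℝ)|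

/-- The σ-field generated by all values `N s, lam s` with `s ≤ t`. -/
abbrev history {Ω : Type*} (N : ℤ → Ω → ℕ) (lam : ℤ → Ω → ℝ≥0) (t : ℤ) : MeasurableSpace Ω :=
  ⨆ s : Set.Iic t, MeasurableSpace.comap (fun ω => (N s ω, lam s ω)) inferInstance

/-- `((N t, lam t))` is a two-sided Poisson count process with intensity function `f`: given the
past of both processes up to time `t - 1`, the count `N t` is Poisson distributed with parameter
`lam t`, and `lam t = f (lam (t - 1)) (N (t - 1))` almost surely. -/
structure IsPoissonCountProcess {Ω : Type*} [MeasurableSpace Ω] (P : Measure Ω)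
    (f : ℝ≥0 → ℕ → ℝ≥0) (N : ℤ → Ω → ℕ) (lam : ℤ → Ω → ℝ≥0) : Prop where
  measurable_count : ∀ t, Measurable (N t)
  measurable_intensity : ∀ t, Measurable (lam t)
  conditional_law : ∀ (t : ℤ) (A : Set ℕ),
    P⟦N t ⁻¹' A | history N lam (t - 1)⟧ =ᵐ[P] fun ω => (poissonMeasure (lam t ω)).real A
  recursion : ∀ t : ℤ, ∀ᵐ ω ∂P, lam t ω = f (lam (t - 1) ω) (N (t - 1) ω)

/-- The law on path space of a process indexed by `ℤ`. -/
def processLaw {Ω S : Type*} [MeasurableSpace Ω] [MeasurableSpace S] (P : Measure Ω)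
    (X : ℤ → Ω → S) : Measure (ℤ → S) :=
  P.map (fun ω t => X t ω)

/-- Strict stationarity: all time shifts of the process have the same law on path space. -/
def IsStationaryProcess {Ω S : Type*} [MeasurableSpace Ω] [MeasurableSpace S] (P : Measure Ω)
    (X : ℤ → Ω → S) : Prop :=
  ∀ h : ℤ, processLaw P (fun t => X (t + h)) = processLaw P X

/-- The left shift on two-sided sequences. -/
def pathShift (S : Type*) (x : ℤ → S) : ℤ → S := fun t => x (t + 1)

/-- A process indexed by `ℤ` is ergodic if the shift is measure preserving and ergodic
with respect to the law of the process on path space. -/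
def IsErgodicProcess {Ω S : Type*} [MeasurableSpace Ω] [MeasurableSpace S] (P : Measure Ω)
    (X : ℤ → Ω → S) : Prop :=
  Ergodic (pathShift S) (processLaw P X)

/-- The past `(N 0, N (-1), N (-2), …)`, which generates `σ(N s : s ≤ 0)`. -/
def pastPath {Ω : Type*} (N : ℤ → Ω → ℕ) (ω : Ω) : ℕ → ℕ := fun k => N (-(k : ℤ)) ω

/-- The future `(N n, N (n+1), …)`, which generates `σ(N s : s ≥ n)`. -/
def futurePath {Ω : Type*} (N : ℤ → Ω → ℕ) (n : ℕ) (ω : Ω) : ℕ → ℕ :=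
  fun k => N ((n : ℤ) + (k : ℤ)) ω

/-- The coefficient of absolute regularity of a stationary count process,
`β(n) = E [ sup { |P(A | N 0, N (-1), …) - P(A)| : A ∈ σ(N n, N (n+1), …) } ]`.
The events `A` are the preimages of measurable sets `B` of paths under the future path, and the
conditional probabilities are taken from the regular conditional distribution of the future
given the past, so that the supremum over all of them is meaningful pointwise. -/
def betaCoeff {Ω : Type*} [MeasurableSpace Ω] (P : Measure Ω) [IsProbabilityMeasure P]
    (N : ℤ → Ω → ℕ) (n : ℕ) : ℝ≥0∞ :=
  ∫⁻ ω, ⨆ (B : Set (ℕ → ℕ)) (_ : MeasurableSet B),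
    ENNReal.ofReal |(condDistrib (futurePath N n) (pastPath N) P (pastPath N ω)).real B
      - P.real (futurePath N n ⁻¹' B)| ∂P

/-- Absolute regularity (β-mixing) of a stationary count process. -/
def IsAbsolutelyRegular {Ω : Type*} [MeasurableSpace Ω] (P : Measure Ω) [IsProbabilityMeasure P]
    (N : ℤ → Ω → ℕ) : Prop :=
  Tendsto (betaCoeff P N) atTop (𝓝 0)

end

/-!
The proof compares the process with itself started from another intensity. `blockMean f k l φ` is
the expectation of `φ [N 1, …, N k]` when the recursion is started from `lam 1 = l`; by the
conditional Poisson law it is the conditional expectation given the past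
(`IsPoissonCountProcess.setIntegral_pathSegment`).

Instead of an explicit coupling, the argument uses that a Poisson expectation of a bounded function
with increments at most `K` is `K`-Lipschitz in the parameter
(`abs_integral_poissonMeasure_sub_le`). With `K = 1` this yields that the law of arbitrarily long
blocks is Lipschitz in the initial intensity, in total variation, with constant `1 / (1 - κ₁)`: if
the first counts agree, the distance of the intensities shrinks by the factor `κ₁`. Applied to
Lipschitz functions, it yields a factor `κ₁ + κ₂` for every count that is discarded at the beginning
of the block (`IsContractive.abs_blockMean_drop_sub_le`). Averaging `|lam 1 - l|` over an
independent copy `l` of `lam 1` gives the bound `2 E[lam 1] κ ^ (n - 1) / (1 - κ₁)` for cylinder events, and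
approximation extends it to the supremum over all events in the definition of `betaCoeff`.

Second moments are finite because `l ^ 2` satisfies a drift condition and the process is stationary
(`IsPoissonCountProcess.lintegral_sq_intensity_lt_top`). As `κ₁ < 1`, the intensity is the limit of
the recursion run over the past counts from intensity `0`
(`IsPoissonCountProcess.intensity_ae_eq_limitIntensity`). The bivariate process is therefore a
factor of the count process, which is ergodic because past and future cylinder events decorrelate.
-/

/-! ### Moments and continuity in the parameter of the Poisson distribution -/

theorem measurable_poissonMeasure_singleton (y : ℕ) :
    Measurable fun r : ℝ≥0 => poissonMeasure r {y} := by
  simp_rw [poissonMeasure_singleton]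
  fun_prop

/-- The Stein–Chen identity `E[n h(n)] = r E[h(n + 1)]`, from which the moments of the Poisson
distribution follow. -/
theorem lintegral_natCast_mul_poissonMeasure (r : ℝ≥0) (h : ℕ → ℝ≥0∞) :
    ∫⁻ n, (n : ℝ≥0∞) * h n ∂poissonMeasure r = r * ∫⁻ n, h (n + 1) ∂poissonMeasure r := by
  rw [lintegral_countable', lintegral_countable', ENNReal.tsum_mul_left.symm,
    tsum_eq_zero_add' ENNReal.summable]
  simp only [Nat.cast_zero, zero_mul, zero_add]
  refine tsum_congr fun n => ?_
  have key : ((n + 1 : ℕ) : ℝ≥0∞) * poissonMeasure r {n + 1} = r * poissonMeasure r {n} := by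
    rw [poissonMeasure_singleton, poissonMeasure_singleton, ← ENNReal.ofReal_natCast,
      ← ENNReal.ofReal_coe_nnreal, ← ENNReal.ofReal_mul (by positivity),
      ← ENNReal.ofReal_mul (by positivity)]
    congr 1
    rw [Nat.factorial_succ]
    push_cast
    rw [pow_succ]
    field_simp
  rw [mul_right_comm, key]
  ring

theorem lintegral_natCast_poissonMeasure (r : ℝ≥0) :
    ∫⁻ n, (n : ℝ≥0∞) ∂poissonMeasure r = r := by
  simpa using lintegral_natCast_mul_poissonMeasure r 1

theorem lintegral_natCast_sq_poissonMeasure (r : ℝ≥0) :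
    ∫⁻ n, (n : ℝ≥0∞) ^ 2 ∂poissonMeasure r = r * (r + 1) := by
  simp_rw [sq]
  rw [lintegral_natCast_mul_poissonMeasure]
  simp_rw [Nat.cast_add, Nat.cast_one]
  rw [lintegral_add_right _ .of_discrete, lintegral_natCast_poissonMeasure]
  simp

theorem integrable_natCast_poissonMeasure (r : ℝ≥0) :
    Integrable (fun n : ℕ => (n : ℝ)) (poissonMeasure r) := by
  refine ⟨.of_discrete, ?_⟩
  have : ∫⁻ n : ℕ, ‖(n : ℝ)‖ₑ ∂poissonMeasure r = r := by
    rw [← lintegral_natCast_poissonMeasure r]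
    refine lintegral_congr fun n => ?_
    rw [Real.enorm_of_nonneg n.cast_nonneg, ENNReal.ofReal_natCast]
  rw [HasFiniteIntegral, this]
  exact ENNReal.coe_lt_top

theorem integral_natCast_poissonMeasure (r : ℝ≥0) :
    ∫ n : ℕ, (n : ℝ) ∂poissonMeasure r = r := by
  rw [integral_eq_lintegral_of_nonneg_ae (.of_forall fun n => n.cast_nonneg) .of_discrete]
  simp_rw [ENNReal.ofReal_natCast]
  rw [lintegral_natCast_poissonMeasure, ENNReal.coe_toReal]

theorem integrable_of_discrete_of_bounded {α : Type*} [MeasurableSpace α]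
    [DiscreteMeasurableSpace α] [Countable α] (μ : Measure α) [IsFiniteMeasure μ]
    {u : α → ℝ} {C : ℝ} (hu : ∀ n, |u n| ≤ C) :
    Integrable u μ :=
  .of_bound .of_discrete C (.of_forall hu)

theorem abs_integral_poissonMeasure_add_sub_le {u : ℕ → ℝ} {C K : ℝ} (hu : ∀ n, |u n| ≤ C)
    (hK : ∀ n, |u (n + 1) - u n| ≤ K) (a d : ℝ≥0) :
    |∫ n, u n ∂poissonMeasure (a + d) - ∫ n, u n ∂poissonMeasure a| ≤ K * d := by
  have hstep : ∀ m n, |u (m + n) - u m| ≤ K * n := by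
    intro m n
    induction n with
    | zero => simp
    | succ n ih =>
      have := abs_sub_le (u (m + n + 1)) (u (m + n)) (u m)
      have := hK (m + n)
      push_cast
      rw [← add_assoc]
      linarith
  rw [← poissonMeasure_conv_poissonMeasure, integral_conv
    (integrable_of_discrete_of_bounded _ hu),
    ← integral_sub (integrable_of_discrete_of_bounded (C := C) _ fun m => ?_)
      (integrable_of_discrete_of_bounded _ hu)]
  · have hin : ∀ m, |∫ n, u (m + n) ∂poissonMeasure d - u m| ≤ K * d := by
      intro m
      have h1 : ∫ n, u (m + n) ∂poissonMeasure d - u m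
          = ∫ n, (u (m + n) - u m) ∂poissonMeasure d := by
        rw [integral_sub (integrable_of_discrete_of_bounded _ fun n => hu (m + n))
          (integrable_const _)]
        simp
      rw [h1]
      rw [← Real.norm_eq_abs]
      calc _ ≤ ∫ n : ℕ, K * (n : ℝ) ∂poissonMeasure d :=
            norm_integral_le_of_norm_le ((integrable_natCast_poissonMeasure d).const_mul K)
              (.of_forall fun n => hstep m n)
        _ = K * d := by rw [integral_const_mul, integral_natCast_poissonMeasure]
    simp_rw [← Real.norm_eq_abs] at hin ⊢
    simpa using norm_integral_le_of_norm_le_const (μ := poissonMeasure a) (.of_forall hin)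
  · simp_rw [← Real.norm_eq_abs] at hu ⊢
    simpa using norm_integral_le_of_norm_le_const (μ := poissonMeasure d)
      (.of_forall fun n => hu (m + n))

/-- If the increments of a bounded function `u` are at most `K`, its Poisson expectation is
`K`-Lipschitz in the parameter, since a `Poisson (a + d)` variable is a `Poisson a` variable plus an
independent one with mean `d`. This covers at once functions that are Lipschitz in the count and
arbitrary functions with values in `[0, 1]`, where `K = 1` gives the total variation bound. -/
theorem abs_integral_poissonMeasure_sub_le {u : ℕ → ℝ} {C K : ℝ} (hu : ∀ n, |u n| ≤ C)
    (hK : ∀ n, |u (n + 1) - u n| ≤ K) (a b : ℝ≥0) :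
    |∫ n, u n ∂poissonMeasure a - ∫ n, u n ∂poissonMeasure b| ≤ K * |(a : ℝ) - b| := by
  rcases le_total a b with hab | hab
  · obtain ⟨d, rfl⟩ := exists_add_of_le hab
    rw [abs_sub_comm]
    refine (abs_integral_poissonMeasure_add_sub_le hu hK a d).trans_eq ?_
    simp
  · obtain ⟨d, rfl⟩ := exists_add_of_le hab
    refine (abs_integral_poissonMeasure_add_sub_le hu hK b d).trans_eq ?_
    simp

/-! ### Cylinder sets of integer sequences -/

/-- The algebra of subsets of `ι → ℕ` generated by the one-coordinate events `{x | x i = y}`. For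
countable `ι` it is countable, unlike the algebra of all events that depend on finitely many
coordinates, so that almost sure statements about its members hold simultaneously. -/
def cylinderAlgebra (ι : Type*) : Set (Set (ι → ℕ)) :=
  generateSetAlgebra (Set.range fun p : ι × ℕ => {x : ι → ℕ | x p.1 = p.2})

theorem countable_cylinderAlgebra (ι : Type*) [Countable ι] : (cylinderAlgebra ι).Countable :=
  countable_generateSetAlgebra (Set.countable_range _)

theorem generateFrom_cylinderAlgebra (ι : Type*) :
    MeasurableSpace.generateFrom (cylinderAlgebra ι) = MeasurableSpace.pi := by
  rw [cylinderAlgebra, generateFrom_generateSetAlgebra_eq]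
  refine le_antisymm (MeasurableSpace.generateFrom_le ?_) (iSup_le fun i => ?_)
  · rintro _ ⟨p, rfl⟩
    exact measurableSet_eq_fun (measurable_pi_apply p.1) measurable_const
  · rw [← measurable_iff_comap_le]
    refine @measurable_to_countable' ℕ (ι → ℕ) _ _ (_) _ fun y => ?_
    exact MeasurableSpace.measurableSet_generateFrom ⟨(i, y), rfl⟩

theorem measurableSet_of_mem_cylinderAlgebra {ι : Type*} {s : Set (ι → ℕ)}
    (hs : s ∈ cylinderAlgebra ι) : MeasurableSet s := by
  rw [← generateFrom_cylinderAlgebra]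
  exact MeasurableSpace.measurableSet_generateFrom hs

theorem exists_finset_of_mem_cylinderAlgebra {ι : Type*} {s : Set (ι → ℕ)}
    (hs : s ∈ cylinderAlgebra ι) :
    ∃ I : Finset ι, ∀ x y : ι → ℕ, (∀ i ∈ I, x i = y i) → (x ∈ s ↔ y ∈ s) := by
  classical
  induction hs with
  | base s hs =>
    obtain ⟨p, rfl⟩ := hs
    exact ⟨{p.1}, fun x y h => by simp [h p.1 (by simp)]⟩
  | empty => exact ⟨∅, by simp⟩
  | compl s _ ih =>
    obtain ⟨I, hI⟩ := ih
    exact ⟨I, fun x y h => not_congr (hI x y h)⟩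
  | union s t _ _ ihs iht =>
    obtain ⟨I, hI⟩ := ihs
    obtain ⟨J, hJ⟩ := iht
    exact ⟨I ∪ J, fun x y h => or_congr (hI x y fun i hi => h i (by simp [hi]))
      (hJ x y fun i hi => h i (by simp [hi]))⟩

open scoped symmDiff in
theorem exists_cylinder_measure_symmDiff_lt {ι : Type*} (μ : Measure (ι → ℕ)) [IsFiniteMeasure μ]
    {s : Set (ι → ℕ)} (hs : MeasurableSet s) {ε : ℝ≥0∞} (hε : 0 < ε) :
    ∃ t ∈ cylinderAlgebra ι, μ (t ∆ s) < ε := by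
  have hA : IsSetAlgebra (cylinderAlgebra ι) := isSetAlgebra_generateSetAlgebra
  refine exists_measure_symmDiff_lt_of_generateFrom_isSetRing hA.isSetRing
    ⟨{Set.univ}, by simp, by simpa using hA.univ_mem, by simp⟩
    (generateFrom_cylinderAlgebra ι).symm hs hε

/-! ### A drift criterion for integrability -/

/-- If `E min(X, M) ≤ E min(q X + c, M)` for all `M`, with `q + q' = 1`, then `q' E X ≤ c`. For a
stationary process with drift `E[X' | X] ≤ q X + c` this gives integrability of `X` without assuming
any in advance. -/
theorem lintegral_le_of_truncated_drift {Ω : Type*} [MeasurableSpace Ω] {P : Measure Ω}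
    [IsProbabilityMeasure P] {X : Ω → ℝ≥0} (hX : Measurable X) {q q' c : ℝ≥0} (hq : q + q' = 1)
    (hdrift : ∀ M : ℕ, ∫⁻ ω, min (X ω : ℝ≥0∞) M ∂P ≤ ∫⁻ ω, min ((q * X ω + c : ℝ≥0) : ℝ≥0∞) M ∂P) :
    q' * ∫⁻ ω, (X ω : ℝ≥0∞) ∂P ≤ c := by
  have hset : ∀ M : ℕ, MeasurableSet {ω | X ω ≤ M} := fun M => measurableSet_le hX measurable_const
  have htrunc : ∀ M : ℕ, q' * ∫⁻ ω, {ω | X ω ≤ M}.indicator (fun ω => (X ω : ℝ≥0∞)) ω ∂P ≤ c := by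
    intro M
    have hpt : ∀ ω, min ((q * X ω + c : ℝ≥0) : ℝ≥0∞) M
        + q' * {ω | X ω ≤ M}.indicator (fun ω => (X ω : ℝ≥0∞)) ω ≤ min (X ω : ℝ≥0∞) M + c := by
      intro ω
      by_cases h : X ω ≤ M
      · have h' : (X ω : ℝ≥0∞) ≤ M := by exact_mod_cast h
        rw [Set.indicator_of_mem (show ω ∈ {ω | X ω ≤ M} from h), min_eq_left h']
        calc _ ≤ ((q * X ω + c : ℝ≥0) : ℝ≥0∞) + q' * X ω := by gcongr; exact min_le_left _ _
          _ = (((q + q') * X ω + c : ℝ≥0) : ℝ≥0∞) := by push_cast; ring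
          _ = X ω + c := by rw [hq, one_mul]; push_cast; rfl
      · have h' : (M : ℝ≥0∞) ≤ X ω := by exact_mod_cast (not_le.1 h).le
        rw [Set.indicator_of_notMem (show ω ∉ {ω | X ω ≤ M} from h), min_eq_right h', mul_zero,
          add_zero]
        exact (min_le_right _ _).trans le_self_add
    have hfin : ∫⁻ ω, min ((q * X ω + c : ℝ≥0) : ℝ≥0∞) M ∂P ≠ ∞ := by
      refine ne_top_of_le_ne_top (ENNReal.natCast_ne_top M) ?_
      calc _ ≤ ∫⁻ _, (M : ℝ≥0∞) ∂P := lintegral_mono fun ω => min_le_right _ _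
        _ = M := by simp
    have hint := lintegral_mono (μ := P) hpt
    have hm : Measurable fun ω => {ω | X ω ≤ M}.indicator (fun ω => (X ω : ℝ≥0∞)) ω :=
      hX.coe_nnreal_ennreal.indicator (hset M)
    rw [lintegral_add_right _ (hm.const_mul _), lintegral_add_right _ measurable_const,
      lintegral_const_mul _ hm] at hint
    have := hint.trans (add_le_add_left (hdrift M) _)
    simpa using (ENNReal.add_le_add_iff_left hfin).1 this
  have hsup : ∫⁻ ω, (X ω : ℝ≥0∞) ∂P
      = ⨆ M : ℕ, ∫⁻ ω, {ω | X ω ≤ M}.indicator (fun ω => (X ω : ℝ≥0∞)) ω ∂P := by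
    rw [← lintegral_iSup (fun M => hX.coe_nnreal_ennreal.indicator (hset M))]
    · refine lintegral_congr fun ω => le_antisymm ?_ (iSup_le fun M => Set.indicator_le_self _ _ _)
      obtain ⟨M, hM⟩ := exists_nat_ge (X ω)
      refine le_iSup_of_le M ?_
      rw [Set.indicator_of_mem (show ω ∈ {ω | X ω ≤ M} from hM)]
    · intro M M' h ω
      refine Set.indicator_le_indicator_of_subset (fun ω hω => ?_) (fun _ => zero_le) ω
      exact (show X ω ≤ M from hω).trans (by exact_mod_cast h)
  rw [hsup, ENNReal.mul_iSup]
  exact iSup_le htrunc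

/-! ### Contractive intensity functions -/

namespace IsContractive

variable {f : ℝ≥0 → ℕ → ℝ≥0} {κ₁ κ₂ : ℝ}

theorem fst_lt_one (hf : IsContractive f κ₁ κ₂) : κ₁ < 1 := by
  linarith [hf.nonneg_snd, hf.sum_lt_one]

theorem abs_sub_fst_le (hf : IsContractive f κ₁ κ₂) (l l' : ℝ≥0) (y : ℕ) :
    |(f l y : ℝ) - f l' y| ≤ κ₁ * |(l : ℝ) - l'| := by
  simpa using hf.bound l l' y y

theorem abs_sub_snd_le (hf : IsContractive f κ₁ κ₂) (l : ℝ≥0) (y : ℕ) :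
    |(f l (y + 1) : ℝ) - f l y| ≤ κ₂ := by
  simpa using hf.bound l l (y + 1) y

theorem continuous_fst (hf : IsContractive f κ₁ κ₂) (y : ℕ) : Continuous fun l => f l y :=
  (LipschitzWith.of_dist_le_mul (K := ⟨κ₁, hf.nonneg_fst⟩) fun l l' =>
    hf.abs_sub_fst_le l l' y).continuous

theorem measurable_uncurry (hf : IsContractive f κ₁ κ₂) :
    Measurable fun p : ℕ × ℝ≥0 => f p.2 p.1 :=
  measurable_from_prod_countable_right fun y => (hf.continuous_fst y).measurable

theorem apply_le (hf : IsContractive f κ₁ κ₂) (l : ℝ≥0) (y : ℕ) :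
    (f l y : ℝ) ≤ f 0 0 + κ₁ * l + κ₂ * y := by
  have := (abs_le.1 (hf.bound l 0 y 0)).2
  simp at this
  linarith

end IsContractive

/-! ### The conditional Poisson law -/

section History

variable {Ω : Type*}

theorem measurable_history_pair (N : ℤ → Ω → ℕ) (lam : ℤ → Ω → ℝ≥0) {s t : ℤ} (hst : s ≤ t) :
    Measurable[history N lam t] fun ω => (N s ω, lam s ω) :=
  measurable_iff_comap_le.2 <| le_iSup (fun s : Set.Iic t =>
    MeasurableSpace.comap (fun ω => (N s ω, lam s ω)) inferInstance) ⟨s, hst⟩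

theorem measurable_history_count (N : ℤ → Ω → ℕ) (lam : ℤ → Ω → ℝ≥0) {s t : ℤ} (hst : s ≤ t) :
    Measurable[history N lam t] (N s) :=
  measurable_fst.comp (measurable_history_pair N lam hst)

theorem history_mono (N : ℤ → Ω → ℕ) (lam : ℤ → Ω → ℝ≥0) {s t : ℤ} (hst : s ≤ t) :
    history N lam s ≤ history N lam t :=
  iSup_le fun r => (measurable_history_pair N lam (r.2.trans hst)).comap_le

end History

section Moments

variable {Ω : Type*} [MeasurableSpace Ω] {P : Measure Ω}
  {f : ℝ≥0 → ℕ → ℝ≥0} {κ₁ κ₂ : ℝ} {N : ℤ → Ω → ℕ} {lam : ℤ → Ω → ℝ≥0}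

namespace IsPoissonCountProcess

theorem history_le (h : IsPoissonCountProcess P f N lam) (t : ℤ) :
    history N lam t ≤ (inferInstance : MeasurableSpace Ω) :=
  iSup_le fun s => ((h.measurable_count s).prodMk (h.measurable_intensity s)).comap_le

/-- The intensity `lam t` is measurable with respect to the past up to time `t - 1` only up to a
null set, because the recursion holds almost surely. -/
theorem aestronglyMeasurable_intensity (h : IsPoissonCountProcess P f N lam)
    (hf : IsContractive f κ₁ κ₂) (t : ℤ) :
    AEStronglyMeasurable[history N lam (t - 1)] (lam t) P := by
  refine ⟨fun ω => f (lam (t - 1) ω) (N (t - 1) ω), Measurable.stronglyMeasurable ?_,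
    h.recursion t⟩
  exact hf.measurable_uncurry.comp (measurable_history_pair N lam le_rfl)

variable [IsProbabilityMeasure P]

theorem measure_inter_count (h : IsPoissonCountProcess P f N lam) (t : ℤ) {s : Set Ω}
    (hs : MeasurableSet[history N lam (t - 1)] s) (y : ℕ) :
    P (s ∩ N t ⁻¹' {y}) = ∫⁻ ω in s, poissonMeasure (lam t ω) {y} ∂P := by
  have hy : MeasurableSet (N t ⁻¹' {y}) := h.measurable_count t (measurableSet_singleton y)
  have h1 := setIntegral_condExp (h.history_le (t - 1)) (μ := P)
    ((integrable_const (1 : ℝ)).indicator hy) hs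
  have hmeas : Measurable fun ω => poissonMeasure (lam t ω) {y} :=
    (measurable_poissonMeasure_singleton y).comp (h.measurable_intensity t)
  rw [integral_congr_ae (ae_restrict_of_ae (h.conditional_law t {y})),
    integral_indicator_const _ hy, measureReal_restrict_apply hy] at h1
  simp_rw [measureReal_def] at h1
  rw [integral_toReal hmeas.aemeasurable (.of_forall fun ω => measure_lt_top _ _), smul_eq_mul,
    mul_one] at h1
  rw [Set.inter_comm]
  refine ((ENNReal.toReal_eq_toReal_iff' ?_ (measure_ne_top _ _)).1 h1).symm
  refine ne_top_of_le_ne_top (measure_ne_top P s) ?_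
  calc _ ≤ ∫⁻ ω in s, 1 ∂P := lintegral_mono fun ω => prob_le_one
    _ = P s := by simp

theorem setLIntegral_count (h : IsPoissonCountProcess P f N lam) (t : ℤ) (y : ℕ) {g : Ω → ℝ≥0∞}
    (hg : Measurable[history N lam (t - 1)] g) :
    ∫⁻ ω in N t ⁻¹' {y}, g ω ∂P = ∫⁻ ω, g ω * poissonMeasure (lam t ω) {y} ∂P := by
  have hm := h.history_le (t - 1)
  have hy : MeasurableSet (N t ⁻¹' {y}) := h.measurable_count t (measurableSet_singleton y)
  have hmeas : Measurable fun ω => poissonMeasure (lam t ω) {y} :=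
    (measurable_poissonMeasure_singleton y).comp (h.measurable_intensity t)
  have htrim : (P.restrict (N t ⁻¹' {y})).trim hm
      = (P.withDensity fun ω => poissonMeasure (lam t ω) {y}).trim hm := by
    refine @Measure.ext _ (history N lam (t - 1)) _ _ fun s hs => ?_
    rw [trim_measurableSet_eq hm hs, trim_measurableSet_eq hm hs,
      Measure.restrict_apply (hm _ hs), withDensity_apply _ (hm _ hs), h.measure_inter_count t hs y]
  rw [← lintegral_trim hm hg, htrim, lintegral_trim hm hg,
    lintegral_withDensity_eq_lintegral_mul _ hmeas (hg.mono hm le_rfl)]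
  simp_rw [Pi.mul_apply, mul_comm]

/-- Integrating out the count `N t` given the past: the conditional Poisson law holds for
functions of `N t` and of the past, the latter only up to null sets. -/
theorem lintegral_count (h : IsPoissonCountProcess P f N lam) (t : ℤ) {φ : Ω → ℕ → ℝ≥0∞}
    (hφ : ∀ y, AEStronglyMeasurable[history N lam (t - 1)] (fun ω => φ ω y) P) :
    ∫⁻ ω, φ ω (N t ω) ∂P = ∫⁻ ω, ∫⁻ y, φ ω y ∂poissonMeasure (lam t ω) ∂P := by
  have hm := h.history_le (t - 1)
  have hy : ∀ y, MeasurableSet (N t ⁻¹' {y}) := fun y =>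
    h.measurable_count t (measurableSet_singleton y)
  have hφ' : ∀ y, AEMeasurable (fun ω => φ ω y) P := fun y => ((hφ y).mono hm).aemeasurable
  have hmeas : ∀ y, Measurable fun ω => poissonMeasure (lam t ω) {y} := fun y =>
    (measurable_poissonMeasure_singleton y).comp (h.measurable_intensity t)
  have hsum : ∀ ω, φ ω (N t ω) = ∑' y, (N t ⁻¹' {y}).indicator (fun ω => φ ω y) ω := by
    intro ω
    rw [tsum_eq_single (N t ω)]
    · simp
    · intro y hyne
      exact Set.indicator_of_notMem (fun hmem => hyne hmem.symm) _
  simp_rw [hsum, lintegral_countable']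
  rw [lintegral_tsum fun y => (hφ' y).indicator (hy y),
    lintegral_tsum (f := fun y ω => φ ω y * poissonMeasure (lam t ω) {y})
      fun y => (hφ' y).mul (hmeas y).aemeasurable]
  refine tsum_congr fun y => ?_
  obtain ⟨ψ, hψ, hφψ⟩ := hφ y
  rw [lintegral_indicator (hy y), lintegral_congr_ae (ae_restrict_of_ae hφψ),
    h.setLIntegral_count t y hψ.measurable]
  refine lintegral_congr_ae ?_
  filter_upwards [hφψ] with ω hω
  rw [hω]

theorem integral_count (h : IsPoissonCountProcess P f N lam) (t : ℤ) {φ : Ω → ℕ → ℝ}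
    (hφ : ∀ y, AEStronglyMeasurable[history N lam (t - 1)] (fun ω => φ ω y) P)
    (h0 : ∀ ω y, 0 ≤ φ ω y) (h1 : ∀ ω y, φ ω y ≤ 1) :
    ∫ ω, φ ω (N t ω) ∂P = ∫ ω, ∫ y, φ ω y ∂poissonMeasure (lam t ω) ∂P := by
  have hm := h.history_le (t - 1)
  have hφ' : ∀ y, AEMeasurable (fun ω => φ ω y) P := fun y => ((hφ y).mono hm).aemeasurable
  have hofReal : ∀ y, AEStronglyMeasurable[history N lam (t - 1)]
      (fun ω => ENNReal.ofReal (φ ω y)) P := fun y =>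
    ENNReal.continuous_ofReal.comp_aestronglyMeasurable (hφ y)
  have hin : ∀ ω, ENNReal.ofReal (∫ y, φ ω y ∂poissonMeasure (lam t ω))
      = ∫⁻ y, ENNReal.ofReal (φ ω y) ∂poissonMeasure (lam t ω) := fun ω =>
    ofReal_integral_eq_lintegral_ofReal (integrable_of_discrete_of_bounded _ (C := 1)
      fun y => abs_le.2 ⟨by linarith [h0 ω y], h1 ω y⟩) (.of_forall (h0 ω))
  have hmeas1 : AEStronglyMeasurable (fun ω => φ ω (N t ω)) P := by
    choose ψ hψ hφψ using hφ
    refine ⟨fun ω => ψ (N t ω) ω, Measurable.stronglyMeasurable ?_, ?_⟩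
    · exact (measurable_from_prod_countable_right (f := fun p : ℕ × Ω => ψ p.1 p.2)
        fun y => ((hψ y).mono hm).measurable).comp ((h.measurable_count t).prodMk measurable_id)
    · filter_upwards [ae_all_iff.2 hφψ] with ω hω using hω _
  have hmeas2 : AEStronglyMeasurable (fun ω => ∫ y, φ ω y ∂poissonMeasure (lam t ω)) P := by
    have heq : ∀ ω, ∫ y, φ ω y ∂poissonMeasure (lam t ω)
        = (∫⁻ y, ENNReal.ofReal (φ ω y) ∂poissonMeasure (lam t ω)).toReal := fun ω => by
      rw [← hin, ENNReal.toReal_ofReal (integral_nonneg (h0 ω))]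
    simp_rw [heq, lintegral_countable', poissonMeasure_singleton]
    refine (AEMeasurable.ennreal_toReal (AEMeasurable.tsum fun y => ?_)).aestronglyMeasurable
    have := h.measurable_intensity t
    have := hφ' y
    fun_prop
  rw [integral_eq_lintegral_of_nonneg_ae (.of_forall fun ω => h0 _ _) hmeas1,
    integral_eq_lintegral_of_nonneg_ae (.of_forall fun ω => integral_nonneg (h0 ω)) hmeas2,
    h.lintegral_count t hofReal]
  simp_rw [hin]

end IsPoissonCountProcess

/-! ### Moments of the intensity -/

theorem IsStationaryProcess.identDistrib [IsProbabilityMeasure P]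
    (hstat : IsStationaryProcess P (fun t ω => (N t ω, lam t ω)))
    (h : IsPoissonCountProcess P f N lam) (s t : ℤ) : IdentDistrib (lam s) (lam t) P P := by
  have hX : ∀ r, Measurable fun ω (u : ℤ) => (N (u + r) ω, lam (u + r) ω) := fun r =>
    measurable_pi_lambda _ fun u => (h.measurable_count _).prodMk (h.measurable_intensity _)
  have hmap : ∀ r, P.map (lam r) = P.map (lam 0) := by
    intro r
    have h1 := congrArg (Measure.map fun x : ℤ → ℕ × ℝ≥0 => (x 0).2) (hstat r)
    simp only [processLaw] at h1
    have hX0 := hX 0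
    simp only [add_zero] at hX0
    rw [Measure.map_map (by fun_prop) (hX r), Measure.map_map (by fun_prop) hX0] at h1
    simpa [Function.comp_def] using h1
  exact ⟨(h.measurable_intensity s).aemeasurable, (h.measurable_intensity t).aemeasurable,
    (hmap s).trans (hmap t).symm⟩

/-- The drift condition for `l ↦ l ^ 2`: with `κ = κ₁ + κ₂` and `b = f 0 0`, one step takes `l ^ 2`
to at most `(b + κ l) ^ 2 + κ₂ ^ 2 l` on average, and `κ ^ 2 < 1`. -/
theorem lintegral_sq_poissonMeasure_le (hf : IsContractive f κ₁ κ₂) :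
    ∃ q q' c : ℝ≥0, q + q' = 1 ∧ 0 < q' ∧ ∀ l : ℝ≥0,
      ∫⁻ y, ((f l y ^ 2 : ℝ≥0) : ℝ≥0∞) ∂poissonMeasure l ≤ ((q * l ^ 2 + c : ℝ≥0) : ℝ≥0∞) := by
  obtain ⟨k₁, hk₁⟩ : ∃ k : ℝ≥0, (k : ℝ) = κ₁ := ⟨⟨κ₁, hf.nonneg_fst⟩, rfl⟩
  obtain ⟨k₂, hk₂⟩ : ∃ k : ℝ≥0, (k : ℝ) = κ₂ := ⟨⟨κ₂, hf.nonneg_snd⟩, rfl⟩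
  have hk : k₁ + k₂ < 1 := by
    rw [← NNReal.coe_lt_coe]; push_cast; rw [hk₁, hk₂]; exact hf.sum_lt_one
  set k := k₁ + k₂ with hkdef
  have hk2 : (k : ℝ) ^ 2 < 1 := by
    have : (k : ℝ) < 1 := by exact_mod_cast hk
    nlinarith [k.coe_nonneg]
  set b := f 0 0 with hb
  obtain ⟨d, hd⟩ : ∃ d : ℝ≥0, (d : ℝ) = (1 - (k : ℝ) ^ 2) / 2 :=
    ⟨⟨(1 - (k : ℝ) ^ 2) / 2, by linarith⟩, rfl⟩
  have hdpos : 0 < (d : ℝ) := by rw [hd]; linarith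
  set e : ℝ≥0 := 2 * b * k + k₂ ^ 2 with he
  refine ⟨k ^ 2 + d, d, b ^ 2 + e ^ 2 / (4 * d), ?_, by exact_mod_cast hdpos, fun l => ?_⟩
  · rw [← NNReal.coe_inj]; push_cast; rw [hd]; ring
  have hfle : ∀ y : ℕ, f l y ≤ b + k₁ * l + k₂ * y := by
    intro y
    rw [← NNReal.coe_le_coe]; push_cast; rw [hk₁, hk₂]; exact hf.apply_le l y
  calc ∫⁻ y, ((f l y ^ 2 : ℝ≥0) : ℝ≥0∞) ∂poissonMeasure l
      ≤ ∫⁻ y : ℕ, (((b + k₁ * l) ^ 2 : ℝ≥0) : ℝ≥0∞)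
          + ((2 * (b + k₁ * l) * k₂ : ℝ≥0) * (y : ℝ≥0∞) + (k₂ ^ 2 : ℝ≥0) * (y : ℝ≥0∞) ^ 2)
          ∂poissonMeasure l := by
        refine lintegral_mono fun y => ?_
        have := pow_le_pow_left₀ (zero_le) (hfle y) 2
        calc ((f l y ^ 2 : ℝ≥0) : ℝ≥0∞) ≤ (((b + k₁ * l + k₂ * y) ^ 2 : ℝ≥0) : ℝ≥0∞) := by
              exact_mod_cast this
          _ = _ := by push_cast; ring
    _ = (((b + k * l) ^ 2 + k₂ ^ 2 * l : ℝ≥0) : ℝ≥0∞) := by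
        rw [lintegral_add_left .of_discrete, lintegral_add_left .of_discrete,
          lintegral_const_mul _ .of_discrete, lintegral_const_mul _ .of_discrete,
          lintegral_natCast_poissonMeasure, lintegral_natCast_sq_poissonMeasure, lintegral_const,
          measure_univ, mul_one, hkdef]
        push_cast
        ring
    _ ≤ _ := by
        rw [ENNReal.coe_le_coe, ← NNReal.coe_le_coe]
        push_cast
        -- complete the square in `e * l ≤ d * l ^ 2 + e ^ 2 / (4 * d)`
        have hsq : (e : ℝ) * l ≤ d * l ^ 2 + e ^ 2 / (4 * d) := by
          have : (d : ℝ) * l ^ 2 + e ^ 2 / (4 * d) - e * l = (2 * d * l - e) ^ 2 / (4 * d) := by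
            field_simp
            ring
          have : 0 ≤ (2 * (d : ℝ) * l - e) ^ 2 / (4 * d) := by positivity
          linarith
        rw [he] at hsq ⊢
        push_cast at hsq ⊢
        linarith

theorem IsPoissonCountProcess.lintegral_sq_intensity_lt_top [IsProbabilityMeasure P]
    (h : IsPoissonCountProcess P f N lam) (hf : IsContractive f κ₁ κ₂)
    (hstat : IsStationaryProcess P (fun t ω => (N t ω, lam t ω))) (t : ℤ) :
    ∫⁻ ω, ((lam t ω ^ 2 : ℝ≥0) : ℝ≥0∞) ∂P < ∞ := by
  obtain ⟨q, q', c, hq, hq', hbound⟩ := lintegral_sq_poissonMeasure_le hf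
  have hX : Measurable fun ω => lam t ω ^ 2 := (h.measurable_intensity t).pow_const 2
  have hdrift : ∀ M : ℕ, ∫⁻ ω, min ((lam t ω ^ 2 : ℝ≥0) : ℝ≥0∞) M ∂P
      ≤ ∫⁻ ω, min ((q * lam t ω ^ 2 + c : ℝ≥0) : ℝ≥0∞) M ∂P := by
    intro M
    have hid := (hstat.identDistrib h t (t + 1)).comp
      (u := fun l : ℝ≥0 => min ((l ^ 2 : ℝ≥0) : ℝ≥0∞) M) (by fun_prop)
    rw [show ∫⁻ ω, min ((lam t ω ^ 2 : ℝ≥0) : ℝ≥0∞) M ∂P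
        = ∫⁻ ω, min ((lam (t + 1) ω ^ 2 : ℝ≥0) : ℝ≥0∞) M ∂P from hid.lintegral_eq]
    have hrec : ∀ᵐ ω ∂P, lam (t + 1) ω = f (lam t ω) (N t ω) := by
      simpa using h.recursion (t + 1)
    calc _ = ∫⁻ ω, min ((f (lam t ω) (N t ω) ^ 2 : ℝ≥0) : ℝ≥0∞) M ∂P := by
          refine lintegral_congr_ae ?_
          filter_upwards [hrec] with ω hω
          rw [hω]
      _ = ∫⁻ ω, ∫⁻ y, min ((f (lam t ω) y ^ 2 : ℝ≥0) : ℝ≥0∞) M ∂poissonMeasure (lam t ω) ∂P := by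
          refine h.lintegral_count t (φ := fun ω y => min ((f (lam t ω) y ^ 2 : ℝ≥0) : ℝ≥0∞) M)
            fun y => ?_
          have hc : Continuous fun l : ℝ≥0 => min ((f l y ^ 2 : ℝ≥0) : ℝ≥0∞) M := by
            have := hf.continuous_fst y
            fun_prop
          exact hc.comp_aestronglyMeasurable (h.aestronglyMeasurable_intensity hf t)
      _ ≤ _ := by
          refine lintegral_mono fun ω => le_min ?_ ?_
          · exact (lintegral_mono fun y => min_le_left _ _).trans (hbound _)
          · exact (lintegral_mono fun y => min_le_right _ _).trans_eq (by simp)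
  have hle := lintegral_le_of_truncated_drift hX hq hdrift
  refine lt_top_iff_ne_top.2 fun htop => ?_
  rw [htop, ENNReal.mul_top (by exact_mod_cast hq'.ne')] at hle
  exact ENNReal.coe_ne_top (top_le_iff.1 hle)

theorem IsPoissonCountProcess.integrable_sq_intensity [IsProbabilityMeasure P]
    (h : IsPoissonCountProcess P f N lam) (hf : IsContractive f κ₁ κ₂)
    (hstat : IsStationaryProcess P (fun t ω => (N t ω, lam t ω))) (t : ℤ) :
    Integrable (fun ω => (lam t ω : ℝ) ^ 2) P := by
  have hm := h.measurable_intensity t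
  refine ⟨by fun_prop, ?_⟩
  refine lt_of_eq_of_lt (lintegral_congr fun ω => ?_) (h.lintegral_sq_intensity_lt_top hf hstat t)
  simp only [← NNReal.coe_pow, NNReal.enorm_eq]

theorem IsPoissonCountProcess.integrable_intensity [IsProbabilityMeasure P]
    (h : IsPoissonCountProcess P f N lam) (hf : IsContractive f κ₁ κ₂)
    (hstat : IsStationaryProcess P (fun t ω => (N t ω, lam t ω))) (t : ℤ) :
    Integrable (fun ω => (lam t ω : ℝ)) P := by
  have hm := h.measurable_intensity t
  refine ((h.integrable_sq_intensity hf hstat t).add (integrable_const 1)).mono'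
    (by fun_prop) (.of_forall fun ω => ?_)
  simp only [NNReal.norm_eq, Pi.add_apply]
  nlinarith [sq_nonneg ((lam t ω : ℝ) - 1), (lam t ω).coe_nonneg]

end Moments

/-! ### The intensity as a function of past counts -/

/-- The intensity obtained by running the recursion over the `k` most recent counts
`z (k - 1), …, z 0` (in this order), starting from intensity `0`. -/
def iteratedIntensity (f : ℝ≥0 → ℕ → ℝ≥0) : ℕ → (ℕ → ℕ) → ℝ≥0
  | 0, _ => 0
  | k + 1, z => f (iteratedIntensity f k fun j => z (j + 1)) (z 0)

/-- The intensity reconstructed from the infinite past `z 0, z 1, …` of counts, as the limit of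
`iteratedIntensity`. The upper limit, taken in `ℝ≥0∞`, makes it defined and measurable on all
sequences; where the iterates converge in `ℝ≥0` it is their limit. -/
noncomputable def limitIntensity (f : ℝ≥0 → ℕ → ℝ≥0) (z : ℕ → ℕ) : ℝ≥0 :=
  (limsup (fun k => (iteratedIntensity f k z : ℝ≥0∞)) atTop).toNNReal

section PastIntensity

variable {f : ℝ≥0 → ℕ → ℝ≥0} {κ₁ κ₂ : ℝ}

theorem measurable_iteratedIntensity (hf : IsContractive f κ₁ κ₂) (k : ℕ) :
    Measurable (iteratedIntensity f k) := by
  induction k with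
  | zero => exact measurable_const
  | succ k ih =>
    have h1 : Measurable fun z : ℕ → ℕ => (z 0, iteratedIntensity f k fun j => z (j + 1)) :=
      (measurable_pi_apply 0).prodMk
        (ih.comp (measurable_pi_lambda _ fun j => measurable_pi_apply (j + 1)))
    exact hf.measurable_uncurry.comp h1

theorem measurable_limitIntensity (hf : IsContractive f κ₁ κ₂) :
    Measurable (limitIntensity f) :=
  (Measurable.limsup fun k =>
    (measurable_iteratedIntensity hf k).coe_nnreal_ennreal).ennreal_toNNReal

/-- Two runs of the recursion with the same counts approach each other at rate `κ₁`. -/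
theorem abs_sub_iteratedIntensity_le (hf : IsContractive f κ₁ κ₂) {n : ℤ → ℕ} {l : ℤ → ℝ≥0}
    (hl : ∀ t, l t = f (l (t - 1)) (n (t - 1))) (k : ℕ) (t : ℤ) :
    |(l t : ℝ) - iteratedIntensity f k fun j => n (t - 1 - j)| ≤ κ₁ ^ k * l (t - k) := by
  induction k generalizing t with
  | zero => simp [iteratedIntensity]
  | succ k ih =>
    have h1 := ih (t - 1)
    rw [hl t, iteratedIntensity]
    refine (hf.bound _ _ _ _).trans ?_
    have hz : (fun j : ℕ => n (t - 1 - ((j + 1 : ℕ) : ℤ))) = fun j : ℕ => n (t - 1 - 1 - j) := by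
      funext j; congr 1; push_cast; ring
    have ht : t - ((k + 1 : ℕ) : ℤ) = t - 1 - k := by push_cast; ring
    rw [hz, ht, pow_succ', mul_assoc]
    have := mul_le_mul_of_nonneg_left h1 hf.nonneg_fst
    simpa using this

variable {Ω : Type*} [MeasurableSpace Ω] {P : Measure Ω} [IsProbabilityMeasure P]
  {N : ℤ → Ω → ℕ} {lam : ℤ → Ω → ℝ≥0}

theorem IsPoissonCountProcess.intensity_ae_eq_limitIntensity
    (h : IsPoissonCountProcess P f N lam) (hf : IsContractive f κ₁ κ₂)
    (hstat : IsStationaryProcess P (fun t ω => (N t ω, lam t ω))) (t : ℤ) :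
    ∀ᵐ ω ∂P, lam t ω = limitIntensity f (fun k => N (t - 1 - (k : ℤ)) ω) := by
  obtain ⟨k₁, hk₁⟩ : ∃ k : ℝ≥0, (k : ℝ) = κ₁ := ⟨⟨κ₁, hf.nonneg_fst⟩, rfl⟩
  have hk₁lt : k₁ < 1 := by rw [← NNReal.coe_lt_coe, hk₁]; exact hf.fst_lt_one
  have hmeas : ∀ k : ℕ, Measurable fun ω => ((k₁ ^ k * lam (t - k) ω : ℝ≥0) : ℝ≥0∞) := fun k =>
    ((h.measurable_intensity _).const_mul _).coe_nnreal_ennreal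
  have hfin : ∫⁻ ω, (lam 0 ω : ℝ≥0∞) ∂P ≠ ∞ := by
    have := (h.integrable_intensity hf hstat 0).2
    simpa [HasFiniteIntegral, NNReal.enorm_eq] using this.ne
  have hsum : ∫⁻ ω, ∑' k : ℕ, ((k₁ ^ k * lam (t - k) ω : ℝ≥0) : ℝ≥0∞) ∂P ≠ ∞ := by
    rw [lintegral_tsum fun k => (hmeas k).aemeasurable]
    have : ∀ k : ℕ, ∫⁻ ω, ((k₁ ^ k * lam (t - k) ω : ℝ≥0) : ℝ≥0∞) ∂P
        = (k₁ : ℝ≥0∞) ^ k * ∫⁻ ω, (lam 0 ω : ℝ≥0∞) ∂P := by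
      intro k
      push_cast
      rw [lintegral_const_mul _ (h.measurable_intensity _).coe_nnreal_ennreal]
      congr 1
      exact ((hstat.identDistrib h (t - k) 0).comp measurable_coe_nnreal_ennreal).lintegral_eq
    simp_rw [this]
    rw [ENNReal.tsum_mul_right, ENNReal.tsum_geometric]
    refine ENNReal.mul_ne_top (ENNReal.inv_ne_top.2 ?_) hfin
    exact (tsub_pos_of_lt (by exact_mod_cast hk₁lt)).ne'
  filter_upwards [ae_lt_top (Measurable.tsum hmeas) hsum, ae_all_iff.2 h.recursion]
    with ω hω hrec
  have hlim := ENNReal.tendsto_atTop_zero_of_tsum_ne_top hω.ne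
  have hlim' : Tendsto (fun k : ℕ => κ₁ ^ k * (lam (t - k) ω : ℝ)) atTop (𝓝 0) := by
    rw [← ENNReal.coe_zero, ENNReal.tendsto_coe, ← NNReal.tendsto_coe] at hlim
    simpa [hk₁] using hlim
  have htend : Tendsto (fun k => iteratedIntensity f k fun j => N (t - 1 - (j : ℤ)) ω) atTop
      (𝓝 (lam t ω)) := by
    rw [tendsto_iff_dist_tendsto_zero]
    refine squeeze_zero (fun _ => dist_nonneg) (fun k => ?_) hlim'
    rw [dist_comm]
    exact abs_sub_iteratedIntensity_le (n := fun t => N t ω) (l := fun t => lam t ω) hf hrec k t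
  rw [limitIntensity, ((ENNReal.tendsto_coe.2 htend).limsup_eq), ENNReal.toNNReal_coe]

end PastIntensity

/-! ### The law of finite blocks of future counts -/

/-- The block `[x (t + 1), …, x (t + k)]` of a two-sided sequence. -/
def pathSegment (x : ℤ → ℕ) : ℤ → ℕ → List ℕ
  | _, 0 => []
  | t, k + 1 => x (t + 1) :: pathSegment x (t + 1) k

theorem pathSegment_getD (x : ℤ → ℕ) (t : ℤ) {k j : ℕ} (hj : j < k) :
    (pathSegment x t k).getD j 0 = x (t + 1 + j) := by
  induction k generalizing t j with
  | zero => omega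
  | succ k ih =>
    cases j with
    | zero => simp [pathSegment]
    | succ j =>
      rw [pathSegment, List.getD_cons_succ, ih (t + 1) (by omega)]
      congr 1
      push_cast
      ring

theorem pathSegment_drop (x : ℤ → ℕ) (t : ℤ) (d k : ℕ) :
    (pathSegment x t (d + k)).drop d = pathSegment x (t + d) k := by
  induction d generalizing t with
  | zero => simp
  | succ d ih =>
    rw [show d + 1 + k = d + k + 1 by ring, pathSegment, List.drop_succ_cons, ih]
    congr 1
    push_cast
    ring

/-- The expectation of `φ [N 1, …, N k]` for the count process started from intensity
`lam 1 = l`. -/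
noncomputable def blockMean (f : ℝ≥0 → ℕ → ℝ≥0) : ℕ → ℝ≥0 → (List ℕ → ℝ) → ℝ
  | 0, _, φ => φ []
  | k + 1, l, φ => ∫ y, blockMean f k (f l y) (fun s => φ (y :: s)) ∂poissonMeasure l

section BlockMean

variable {f : ℝ≥0 → ℕ → ℝ≥0} {κ₁ κ₂ : ℝ}

theorem blockMean_mem_Icc (k : ℕ) (l : ℝ≥0) {φ : List ℕ → ℝ} (hφ : ∀ s, φ s ∈ Set.Icc 0 1) :
    blockMean f k l φ ∈ Set.Icc 0 1 := by
  induction k generalizing l φ with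
  | zero => exact hφ []
  | succ k ih =>
    have hin : ∀ y, blockMean f k (f l y) (fun s => φ (y :: s)) ∈ Set.Icc 0 1 := fun y =>
      ih _ fun s => hφ _
    refine ⟨integral_nonneg fun y => (hin y).1, ?_⟩
    calc _ ≤ ∫ _, (1 : ℝ) ∂poissonMeasure l :=
          integral_mono (integrable_of_discrete_of_bounded _ (C := 1) fun y =>
            abs_le.2 ⟨by linarith [(hin y).1], (hin y).2⟩) (integrable_const _) fun y => (hin y).2
      _ = 1 := by simp

/-- One step of the recursion: if `h` is `L`-Lipschitz in the new intensity, and a change of the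
count by one, including its effect on the new intensity, changes `h` by at most `K`, then the
expectation after one step is `(L κ₁ + K)`-Lipschitz in the old intensity. -/
theorem IsContractive.abs_integral_step_sub_le (hf : IsContractive f κ₁ κ₂) {h : ℕ → ℝ≥0 → ℝ}
    (hh : ∀ y l, h y l ∈ Set.Icc 0 1) {L K : ℝ} (hL0 : 0 ≤ L)
    (hL : ∀ y l l', |h y l - h y l'| ≤ L * |(l : ℝ) - l'|)
    (hK : ∀ l y, |h (y + 1) (f l (y + 1)) - h y (f l y)| ≤ K) (l l' : ℝ≥0) :
    |∫ y, h y (f l y) ∂poissonMeasure l - ∫ y, h y (f l' y) ∂poissonMeasure l'|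
      ≤ (L * κ₁ + K) * |(l : ℝ) - l'| := by
  have hb : ∀ m y, |h y (f m y)| ≤ 1 := fun m y =>
    abs_le.2 ⟨by linarith [(hh y (f m y)).1], (hh y (f m y)).2⟩
  have hint : ∀ m, Integrable (fun y => h y (f m y)) (poissonMeasure l) := fun m =>
    integrable_of_discrete_of_bounded _ (hb m)
  have h1 : |∫ y, h y (f l y) ∂poissonMeasure l - ∫ y, h y (f l' y) ∂poissonMeasure l|
      ≤ L * κ₁ * |(l : ℝ) - l'| := by
    rw [← integral_sub (hint l) (hint l'), ← Real.norm_eq_abs]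
    refine (norm_integral_le_of_norm_le_const (C := L * κ₁ * |(l : ℝ) - l'|)
      (.of_forall fun y => ?_)).trans_eq (by simp)
    rw [mul_assoc]
    exact (hL y _ _).trans (mul_le_mul_of_nonneg_left (hf.abs_sub_fst_le l l' y) hL0)
  have h2 := abs_integral_poissonMeasure_sub_le (hb l') (hK l') l l'
  have := abs_sub_le (∫ y, h y (f l y) ∂poissonMeasure l) (∫ y, h y (f l' y) ∂poissonMeasure l)
    (∫ y, h y (f l' y) ∂poissonMeasure l')
  linarith

/-- The law of a block depends on the initial intensity in a Lipschitz way in total variation,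
with a constant independent of the length of the block: two processes started from `l` and `l'` can
be coupled so that their first counts differ with probability at most `|l - l'|`; if these agree,
the next intensities are at distance at most `κ₁ * |l - l'|`, and `(1 - κ₁)⁻¹` solves
`c = 1 + κ₁ c`. -/
theorem IsContractive.abs_blockMean_sub_le (hf : IsContractive f κ₁ κ₂) (k : ℕ) {φ : List ℕ → ℝ}
    (hφ : ∀ s, φ s ∈ Set.Icc 0 1) (l l' : ℝ≥0) :
    |blockMean f k l φ - blockMean f k l' φ| ≤ (1 - κ₁)⁻¹ * |(l : ℝ) - l'| := by
  have hκ : 0 < 1 - κ₁ := sub_pos.2 hf.fst_lt_one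
  have hinv : 0 ≤ (1 - κ₁)⁻¹ := inv_nonneg.2 hκ.le
  induction k generalizing φ l l' with
  | zero => simpa [blockMean] using mul_nonneg hinv (abs_nonneg _)
  | succ k ih =>
    have hmem : ∀ y m, blockMean f k m (fun s => φ (y :: s)) ∈ Set.Icc 0 1 := fun y m =>
      blockMean_mem_Icc k m fun s => hφ _
    refine (hf.abs_integral_step_sub_le (h := fun y m => blockMean f k m fun s => φ (y :: s))
      (K := 1) hmem hinv (fun y m m' => ih (fun s => hφ _) m m') (fun m y => ?_) l l').trans_eq ?_
    · have := hmem (y + 1) (f m (y + 1))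
      have := hmem y (f m y)
      exact abs_le.2 ⟨by simp at *; linarith, by simp at *; linarith⟩
    · congr 1
      field_simp
      ring

/-- Each discarded initial count improves the Lipschitz constant by the factor `κ₁ + κ₂`. -/
theorem IsContractive.abs_blockMean_drop_sub_le (hf : IsContractive f κ₁ κ₂) (d k : ℕ)
    {φ : List ℕ → ℝ} (hφ : ∀ s, φ s ∈ Set.Icc 0 1) (l l' : ℝ≥0) :
    |blockMean f (d + k) l (fun s => φ (s.drop d)) - blockMean f (d + k) l' fun s => φ (s.drop d)|
      ≤ (κ₁ + κ₂) ^ d / (1 - κ₁) * |(l : ℝ) - l'| := by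
  have hκ : 0 < 1 - κ₁ := sub_pos.2 hf.fst_lt_one
  have hκ' : 0 ≤ κ₁ + κ₂ := add_nonneg hf.nonneg_fst hf.nonneg_snd
  induction d generalizing l l' with
  | zero => simpa using hf.abs_blockMean_sub_le k hφ l l'
  | succ d ih =>
    have hL : 0 ≤ (κ₁ + κ₂) ^ d / (1 - κ₁) := by positivity
    rw [show d + 1 + k = d + k + 1 by ring]
    refine (hf.abs_integral_step_sub_le
      (h := fun _ m => blockMean f (d + k) m fun s => φ (s.drop d))
      (fun y m => blockMean_mem_Icc _ m fun s => hφ _) hL (fun _ => ih)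
      (K := (κ₁ + κ₂) ^ d / (1 - κ₁) * κ₂) (fun m y => ?_) l l').trans_eq ?_
    · exact (ih _ _).trans (mul_le_mul_of_nonneg_left (hf.abs_sub_snd_le m y) hL)
    · rw [pow_succ]; ring

theorem IsContractive.continuous_blockMean (hf : IsContractive f κ₁ κ₂) (k : ℕ) {φ : List ℕ → ℝ}
    (hφ : ∀ s, φ s ∈ Set.Icc 0 1) : Continuous fun l => blockMean f k l φ :=
  (LipschitzWith.of_dist_le_mul
    (K := ⟨(1 - κ₁)⁻¹, inv_nonneg.2 (sub_pos.2 hf.fst_lt_one).le⟩) fun l l' =>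
    hf.abs_blockMean_sub_le k hφ l l').continuous

end BlockMean

section Markov

variable {f : ℝ≥0 → ℕ → ℝ≥0} {κ₁ κ₂ : ℝ}
  {Ω : Type*} [MeasurableSpace Ω] {P : Measure Ω} {N : ℤ → Ω → ℕ} {lam : ℤ → Ω → ℝ≥0}

theorem measurable_comp_pathSegment {t : ℤ} {k : ℕ}
    (hN : ∀ s, t < s → s ≤ t + k → Measurable (N s)) (φ : List ℕ → ℝ) :
    Measurable fun ω => φ (pathSegment (fun s => N s ω) t k) := by
  induction k generalizing t φ with
  | zero => simp [pathSegment]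
  | succ k ih =>
    have hN' : ∀ s, t + 1 < s → s ≤ t + 1 + k → Measurable (N s) := fun s h1 h2 =>
      hN s (by omega) (by push_cast; omega)
    exact (measurable_from_prod_countable_right
      (f := fun p : ℕ × Ω => φ (p.1 :: pathSegment (fun s => N s p.2) (t + 1) k))
      fun y => ih hN' fun s => φ (y :: s)).comp
        ((hN (t + 1) (by omega) (by push_cast; omega)).prodMk measurable_id)

variable [IsProbabilityMeasure P]

/-- The Markov property: given the past up to time `t`, the next `k` counts have the law of the
count process started from `lam (t + 1)`. -/
theorem IsPoissonCountProcess.setIntegral_pathSegment (h : IsPoissonCountProcess P f N lam)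
    (hf : IsContractive f κ₁ κ₂) (t : ℤ) (k : ℕ) {φ : List ℕ → ℝ}
    (hφ : ∀ s, φ s ∈ Set.Icc 0 1) {A : Set Ω} (hA : MeasurableSet[history N lam t] A) :
    ∫ ω in A, φ (pathSegment (fun s => N s ω) t k) ∂P
      = ∫ ω in A, blockMean f k (lam (t + 1) ω) φ ∂P := by
  induction k generalizing t φ A with
  | zero => rfl
  | succ k ih =>
    have hAm : MeasurableSet A := h.history_le t _ hA
    have hcount := h.measurable_count (t + 1)
    have hpart : ∀ y, MeasurableSet[history N lam (t + 1)] (A ∩ N (t + 1) ⁻¹' {y}) := fun y =>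
      (history_mono N lam (by omega) _ hA).inter
        (measurable_history_count N lam le_rfl (measurableSet_singleton y))
    have hunion : A = ⋃ y, A ∩ N (t + 1) ⁻¹' {y} := by
      ext ω; simp
    have hdisj : Pairwise (Function.onFun Disjoint fun y => A ∩ N (t + 1) ⁻¹' {y}) := by
      intro y y' hyy'
      refine Set.disjoint_left.2 fun ω hω hω' => hyy' ?_
      exact hω.2.symm.trans hω'.2
    have hbd : ∀ m y, blockMean f k m (fun s => φ (y :: s)) ∈ Set.Icc 0 1 := fun m y =>
      blockMean_mem_Icc k m fun s => hφ _
    have hbdd : ∀ x : ℝ, x ∈ Set.Icc (0 : ℝ) 1 → ‖x‖ ≤ 1 := fun x hx =>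
      abs_le.2 ⟨by linarith [hx.1], hx.2⟩
    have hBm : Measurable fun ω => blockMean f k (lam (t + 1 + 1) ω)
        (fun s => φ (N (t + 1) ω :: s)) :=
      (measurable_from_prod_countable_right
        (f := fun p : ℕ × ℝ≥0 => blockMean f k p.2 (fun s => φ (p.1 :: s)))
        fun y => (hf.continuous_blockMean k fun s => hφ (y :: s)).measurable).comp
        (hcount.prodMk (h.measurable_intensity _))
    have hint1 : Integrable (fun ω => φ (pathSegment (fun s => N s ω) t (k + 1))) P :=
      .of_bound (measurable_comp_pathSegment
        (fun s _ _ => h.measurable_count s) φ).aestronglyMeasurable 1 (.of_forall fun ω => hbdd _ (hφ _))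
    have hint2 : Integrable (fun ω => blockMean f k (lam (t + 1 + 1) ω)
        (fun s => φ (N (t + 1) ω :: s))) P :=
      .of_bound hBm.aestronglyMeasurable 1 (.of_forall fun ω => hbdd _ (hbd _ _))
    -- condition on the past up to time `t + 1`, on each event `N (t + 1) = y`
    have hstep : ∫ ω in A, φ (pathSegment (fun s => N s ω) t (k + 1)) ∂P
        = ∫ ω in A, blockMean f k (lam (t + 1 + 1) ω) (fun s => φ (N (t + 1) ω :: s)) ∂P := by
      rw [hunion, integral_iUnion (fun y => h.history_le _ _ (hpart y)) hdisj hint1.integrableOn,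
        integral_iUnion (fun y => h.history_le _ _ (hpart y)) hdisj hint2.integrableOn]
      refine tsum_congr fun y => ?_
      have e1 := ih (t + 1) (φ := fun s => φ (y :: s)) (fun s => hφ _) (hpart y)
      rw [setIntegral_congr_fun (h.history_le _ _ (hpart y))
          (g := fun ω => φ (y :: pathSegment (fun s => N s ω) (t + 1) k)) fun ω hω => ?_, e1,
        setIntegral_congr_fun (h.history_le _ _ (hpart y)) fun ω hω => ?_]
      · have : N (t + 1) ω = y := hω.2
        simp only [this]
      · have : N (t + 1) ω = y := hω.2
        simp only [pathSegment, this]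
    have hrec : ∀ᵐ ω ∂P, lam (t + 1 + 1) ω = f (lam (t + 1) ω) (N (t + 1) ω) := by
      simpa using h.recursion (t + 1 + 1)
    rw [hstep, ← integral_indicator hAm, ← integral_indicator hAm]
    -- then integrate out `N (t + 1)` given the past up to time `t`
    have hcalc := h.integral_count (t + 1) (φ := fun ω y => A.indicator
      (fun ω => blockMean f k (f (lam (t + 1) ω) y) fun s => φ (y :: s)) ω) ?_ ?_ ?_
    · rw [integral_congr_ae (g := fun ω => A.indicator
        (fun ω' => blockMean f k (f (lam (t + 1) ω') (N (t + 1) ω))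
          fun s => φ (N (t + 1) ω :: s)) ω) ?_, hcalc]
      · refine integral_congr_ae (.of_forall fun ω => ?_)
        by_cases hω : ω ∈ A <;> simp [hω, blockMean]
      · filter_upwards [hrec] with ω hω
        by_cases hωA : ω ∈ A <;> simp [hωA, hω]
    · intro y
      have hA' : MeasurableSet[history N lam (t + 1 - 1)] A := by rwa [add_sub_cancel_right]
      have hc : Continuous fun l => blockMean f k (f l y) fun s => φ (y :: s) :=
        (hf.continuous_blockMean k fun s => hφ (y :: s)).comp (hf.continuous_fst y)
      obtain ⟨ψ, hψ, hae⟩ :=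
        hc.comp_aestronglyMeasurable (h.aestronglyMeasurable_intensity hf (t + 1))
      refine ⟨A.indicator ψ, hψ.indicator hA', ?_⟩
      filter_upwards [hae] with ω hω
      by_cases hωA : ω ∈ A <;> simp [hωA, ← hω]
    · intro ω y
      exact Set.indicator_nonneg (fun ω _ => (hbd _ y).1) ω
    · intro ω y
      exact Set.indicator_le' (fun ω _ => (hbd _ y).2) (fun _ _ => zero_le_one) ω

end Markov

/-! ### Decorrelation of past and future -/

section Mixing

variable {f : ℝ≥0 → ℕ → ℝ≥0} {κ₁ κ₂ : ℝ}
  {Ω : Type*} [MeasurableSpace Ω] {P : Measure Ω} {N : ℤ → Ω → ℕ} {lam : ℤ → Ω → ℝ≥0}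
  [IsProbabilityMeasure P]

theorem IsPoissonCountProcess.integrable_blockMean (h : IsPoissonCountProcess P f N lam)
    (hf : IsContractive f κ₁ κ₂) (t : ℤ) (k : ℕ) {φ : List ℕ → ℝ}
    (hφ : ∀ s, φ s ∈ Set.Icc 0 1) : Integrable (fun ω => blockMean f k (lam t ω) φ) P := by
  refine .of_bound ((hf.continuous_blockMean k hφ).measurable.comp
    (h.measurable_intensity t)).aestronglyMeasurable 1 (.of_forall fun ω => abs_le.2 ?_)
  have := blockMean_mem_Icc (f := f) k (lam t ω) hφ
  exact ⟨by linarith [this.1], this.2⟩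

theorem IsPoissonCountProcess.abs_blockMean_drop_sub_integral_le
    (h : IsPoissonCountProcess P f N lam) (hf : IsContractive f κ₁ κ₂)
    (hstat : IsStationaryProcess P (fun t ω => (N t ω, lam t ω))) (t : ℤ) (d k : ℕ)
    {φ : List ℕ → ℝ} (hφ : ∀ s, φ s ∈ Set.Icc 0 1) (l : ℝ≥0) :
    |blockMean f (d + k) l (fun s => φ (s.drop d))
        - ∫ ω, blockMean f (d + k) (lam t ω) (fun s => φ (s.drop d)) ∂P|
      ≤ (κ₁ + κ₂) ^ d / (1 - κ₁) * (l + ∫ ω, (lam t ω : ℝ) ∂P) := by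
  have hκ : 0 < 1 - κ₁ := sub_pos.2 hf.fst_lt_one
  have hκ' : 0 ≤ κ₁ + κ₂ := add_nonneg hf.nonneg_fst hf.nonneg_snd
  have hC : 0 ≤ (κ₁ + κ₂) ^ d / (1 - κ₁) := by positivity
  have hlam := h.integrable_intensity hf hstat t
  have hB := h.integrable_blockMean hf t (d + k) (φ := fun s => φ (s.drop d)) fun s => hφ _
  have h1 : blockMean f (d + k) l (fun s => φ (s.drop d))
        - ∫ ω, blockMean f (d + k) (lam t ω) (fun s => φ (s.drop d)) ∂P
      = ∫ ω, (blockMean f (d + k) l (fun s => φ (s.drop d))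
        - blockMean f (d + k) (lam t ω) (fun s => φ (s.drop d))) ∂P := by
    rw [integral_sub (integrable_const _) hB]
    simp
  rw [h1, ← Real.norm_eq_abs]
  calc _ ≤ ∫ ω, (κ₁ + κ₂) ^ d / (1 - κ₁) * ((l : ℝ) + lam t ω) ∂P := by
        refine norm_integral_le_of_norm_le (((integrable_const _).add hlam).const_mul _)
          (.of_forall fun ω => (hf.abs_blockMean_drop_sub_le d k hφ l (lam t ω)).trans ?_)
        refine mul_le_mul_of_nonneg_left ?_ hC
        exact abs_sub_le_of_nonneg_of_le l.coe_nonneg (by simp) (by simp) (by simp)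
    _ = _ := by
        rw [integral_const_mul, integral_add (integrable_const _) hlam]
        simp

/-- Events of the past up to time `t` decorrelate from blocks of counts that begin after time
`t + d` at the rate `(κ₁ + κ₂) ^ d`, uniformly in the length of the block. -/
theorem IsPoissonCountProcess.abs_setIntegral_pathSegment_sub_le
    (h : IsPoissonCountProcess P f N lam) (hf : IsContractive f κ₁ κ₂)
    (hstat : IsStationaryProcess P (fun t ω => (N t ω, lam t ω))) (t : ℤ) (d k : ℕ)
    {φ : List ℕ → ℝ} (hφ : ∀ s, φ s ∈ Set.Icc 0 1) {A : Set Ω}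
    (hA : MeasurableSet[history N lam t] A) :
    |∫ ω in A, φ (pathSegment (fun s => N s ω) (t + d) k) ∂P
        - P.real A * ∫ ω, φ (pathSegment (fun s => N s ω) (t + d) k) ∂P|
      ≤ (κ₁ + κ₂) ^ d / (1 - κ₁) * (2 * ∫ ω, (lam (t + 1) ω : ℝ) ∂P) := by
  have hκ : 0 < 1 - κ₁ := sub_pos.2 hf.fst_lt_one
  have hκ' : 0 ≤ κ₁ + κ₂ := add_nonneg hf.nonneg_fst hf.nonneg_snd
  have hC : 0 ≤ (κ₁ + κ₂) ^ d / (1 - κ₁) := by positivity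
  have hlam := h.integrable_intensity hf hstat (t + 1)
  have hφd : ∀ s : List ℕ, φ (s.drop d) ∈ Set.Icc (0 : ℝ) 1 := fun s => hφ _
  have hB := h.integrable_blockMean hf (t + 1) (d + k) hφd
  have e1 := h.setIntegral_pathSegment hf t (d + k) hφd hA
  have e2 := h.setIntegral_pathSegment hf t (d + k) hφd (A := Set.univ) MeasurableSet.univ
  simp only [pathSegment_drop, setIntegral_univ] at e1 e2
  rw [e1, e2, ← smul_eq_mul, ← setIntegral_const,
    ← integral_sub hB.integrableOn (integrable_const _).integrableOn, ← Real.norm_eq_abs]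
  have hint : Integrable (fun ω => (κ₁ + κ₂) ^ d / (1 - κ₁) *
      ((lam (t + 1) ω : ℝ) + ∫ ω, (lam (t + 1) ω : ℝ) ∂P)) P :=
    (hlam.add (integrable_const _)).const_mul _
  calc _ ≤ ∫ ω in A, (κ₁ + κ₂) ^ d / (1 - κ₁) *
          ((lam (t + 1) ω : ℝ) + ∫ ω, (lam (t + 1) ω : ℝ) ∂P) ∂P :=
        norm_integral_le_of_norm_le hint.integrableOn (.of_forall fun ω =>
          h.abs_blockMean_drop_sub_integral_le hf hstat (t + 1) d k hφ _)
    _ ≤ ∫ ω, (κ₁ + κ₂) ^ d / (1 - κ₁) *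
          ((lam (t + 1) ω : ℝ) + ∫ ω, (lam (t + 1) ω : ℝ) ∂P) ∂P :=
        setIntegral_le_integral hint (.of_forall fun ω => mul_nonneg hC
          (add_nonneg (NNReal.coe_nonneg _) (integral_nonneg fun ω => NNReal.coe_nonneg _)))
    _ = _ := by
        rw [integral_const_mul, integral_add hlam (integrable_const _)]
        simp only [integral_const, probReal_univ, smul_eq_mul]
        ring

end Mixing

/-! ### Absolute regularity -/

open scoped symmDiff in
/-- A bound on the difference of two finite measures on cylinder sets extends to all measurable
sets by approximation. -/
theorem abs_measureReal_sub_le_of_cylinderAlgebra {ι : Type*} (μ ν : Measure (ι → ℕ))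
    [IsFiniteMeasure μ] [IsFiniteMeasure ν] {b : ℝ}
    (hb : ∀ C ∈ cylinderAlgebra ι, |μ.real C - ν.real C| ≤ b) {B : Set (ι → ℕ)}
    (hB : MeasurableSet B) : |μ.real B - ν.real B| ≤ b := by
  refine le_of_forall_pos_le_add fun ε hε => ?_
  obtain ⟨C, hC, hlt⟩ := exists_cylinder_measure_symmDiff_lt (μ + ν) hB
    (ENNReal.ofReal_pos.2 (half_pos hε))
  have hCm := measurableSet_of_mem_cylinderAlgebra hC
  have hreal : μ.real (C ∆ B) + ν.real (C ∆ B) ≤ ε / 2 := by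
    rw [← measureReal_add_apply]
    exact ENNReal.toReal_le_of_le_ofReal (half_pos hε).le hlt.le
  have hμ := abs_measureReal_sub_le_measureReal_symmDiff (μ := μ) hCm.nullMeasurableSet
    hB.nullMeasurableSet
  have hν := abs_measureReal_sub_le_measureReal_symmDiff (μ := ν) hCm.nullMeasurableSet
    hB.nullMeasurableSet
  have := hb C hC
  rw [abs_le] at *
  constructor <;> linarith

/-- The indicator of a cylinder set of one-sided sequences, as a function of a finite block. -/
theorem exists_block_functional {B : Set (ℕ → ℕ)} (hB : B ∈ cylinderAlgebra ℕ) :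
    ∃ (k : ℕ) (φ : List ℕ → ℝ), (∀ s, φ s ∈ Set.Icc 0 1) ∧
      ∀ (x : ℤ → ℕ) (t : ℤ), φ (pathSegment x t k) = B.indicator 1 fun j => x (t + 1 + j) := by
  classical
  obtain ⟨I, hI⟩ := exists_finset_of_mem_cylinderAlgebra hB
  refine ⟨I.sup id + 1, fun s => B.indicator 1 fun j => s.getD j 0, fun s => ?_, fun x t => ?_⟩
  · exact ⟨Set.indicator_nonneg (fun _ _ => zero_le_one) _,
      Set.indicator_le' (fun _ _ => le_rfl) (fun _ _ => zero_le_one) _⟩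
  · have := hI (fun j => (pathSegment x t (I.sup id + 1)).getD j 0) (fun j => x (t + 1 + j))
      fun i hi => pathSegment_getD x t (Nat.lt_succ_of_le (Finset.le_sup (f := id) hi))
    simp only [Set.indicator_apply, this, Pi.one_apply]

theorem futurePath_succ {Ω : Type*} (N : ℤ → Ω → ℕ) (d : ℕ) (ω : Ω) :
    futurePath N (d + 1) ω = fun j : ℕ => N ((d : ℤ) + 1 + j) ω := by
  funext j
  simp [futurePath]

theorem comap_pastPath_le_history {Ω : Type*} (N : ℤ → Ω → ℕ) (lam : ℤ → Ω → ℝ≥0) :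
    MeasurableSpace.comap (pastPath N) inferInstance ≤ history N lam 0 := by
  rw [← measurable_iff_comap_le]
  exact @measurable_pi_lambda _ _ _ (history N lam 0) _ _ fun k =>
    measurable_history_count N lam (by omega)

section AbsoluteRegularity

variable {f : ℝ≥0 → ℕ → ℝ≥0} {κ₁ κ₂ : ℝ}
  {Ω : Type*} [MeasurableSpace Ω] {P : Measure Ω} {N : ℤ → Ω → ℕ} {lam : ℤ → Ω → ℝ≥0}
  [IsProbabilityMeasure P]

theorem measurable_pastPath (hN : ∀ t, Measurable (N t)) : Measurable (pastPath N) :=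
  measurable_pi_lambda _ fun _ => hN _

theorem measurable_futurePath (hN : ∀ t, Measurable (N t)) (n : ℕ) :
    Measurable (futurePath N n) :=
  measurable_pi_lambda _ fun _ => hN _

/-- The past of the counts alone determines `lam 1` almost surely, so the regular conditional
distribution of the future given the counts up to time `0` is that of the count process started from
`lam 1`. -/
theorem IsPoissonCountProcess.condDistrib_ae_eq_blockMean
    (h : IsPoissonCountProcess P f N lam) (hf : IsContractive f κ₁ κ₂)
    (hstat : IsStationaryProcess P (fun t ω => (N t ω, lam t ω))) (d k : ℕ)
    {B : Set (ℕ → ℕ)} (hB : MeasurableSet B) {φ : List ℕ → ℝ} (hφ : ∀ s, φ s ∈ Set.Icc 0 1)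
    (hφB : ∀ (x : ℤ → ℕ) (t : ℤ),
      φ (pathSegment x t k) = B.indicator 1 fun j => x (t + 1 + j)) :
    ∀ᵐ ω ∂P, (condDistrib (futurePath N (d + 1)) (pastPath N) P (pastPath N ω)).real B
      = blockMean f (d + k) (lam 1 ω) fun s => φ (s.drop d) := by
  have hX := measurable_pastPath h.measurable_count
  have hY := measurable_futurePath h.measurable_count (d + 1)
  have hφd : ∀ s : List ℕ, φ (s.drop d) ∈ Set.Icc (0 : ℝ) 1 := fun s => hφ _
  have hBint := h.integrable_blockMean hf 1 (d + k) hφd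
  refine (condDistrib_ae_eq_condExp hX hY hB).trans ?_
  symm
  refine ae_eq_condExp_of_forall_setIntegral_eq hX.comap_le
    ((integrable_const (1 : ℝ)).indicator (hY hB)) (fun _ _ _ => hBint.integrableOn) ?_ ?_
  · intro A hA _
    have e := h.setIntegral_pathSegment hf 0 (d + k) hφd (comap_pastPath_le_history N lam _ hA)
    simp only [pathSegment_drop, hφB, zero_add] at e
    rw [← e]
    refine integral_congr_ae (.of_forall fun ω => ?_)
    have := futurePath_succ N d ω
    by_cases hω : futurePath N (d + 1) ω ∈ B
    · simp [hω, ← this]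
    · simp [hω, ← this]
  · refine ⟨fun ω => blockMean f (d + k) (limitIntensity f (pastPath N ω)) fun s => φ (s.drop d),
      Measurable.stronglyMeasurable ?_, ?_⟩
    · exact (((hf.continuous_blockMean (d + k) hφd).measurable).comp
        (measurable_limitIntensity hf)).comp (comap_measurable _)
    · filter_upwards [h.intensity_ae_eq_limitIntensity hf hstat 1] with ω hω
      have : pastPath N ω = fun k : ℕ => N (1 - 1 - (k : ℤ)) ω := by
        funext k; simp [pastPath]
      rw [this, ← hω]

theorem IsPoissonCountProcess.betaCoeff_le (h : IsPoissonCountProcess P f N lam)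
    (hf : IsContractive f κ₁ κ₂)
    (hstat : IsStationaryProcess P (fun t ω => (N t ω, lam t ω))) (d : ℕ) :
    betaCoeff P N (d + 1)
      ≤ ENNReal.ofReal (2 * (∫ ω, (lam 1 ω : ℝ) ∂P) * (κ₁ + κ₂) ^ d / (1 - κ₁)) := by
  have hκ : 0 < 1 - κ₁ := sub_pos.2 hf.fst_lt_one
  have hκ' : 0 ≤ κ₁ + κ₂ := add_nonneg hf.nonneg_fst hf.nonneg_snd
  have hC : 0 ≤ (κ₁ + κ₂) ^ d / (1 - κ₁) := by positivity
  have hY := measurable_futurePath h.measurable_count (d + 1)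
  have hlam := h.integrable_intensity hf hstat 1
  have hcyl : ∀ B ∈ cylinderAlgebra ℕ, ∀ᵐ ω ∂P,
      |(condDistrib (futurePath N (d + 1)) (pastPath N) P (pastPath N ω)).real B
        - (P.map (futurePath N (d + 1))).real B|
      ≤ (κ₁ + κ₂) ^ d / (1 - κ₁) * (lam 1 ω + ∫ ω, (lam 1 ω : ℝ) ∂P) := by
    intro B hB
    obtain ⟨k, φ, hφ, hφB⟩ := exists_block_functional hB
    have hBm := measurableSet_of_mem_cylinderAlgebra hB
    have hP : (P.map (futurePath N (d + 1))).real B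
        = ∫ ω, blockMean f (d + k) (lam 1 ω) (fun s => φ (s.drop d)) ∂P := by
      have e := h.setIntegral_pathSegment hf 0 (d + k) (φ := fun s => φ (s.drop d))
        (fun s => hφ _) (A := Set.univ) MeasurableSet.univ
      simp only [pathSegment_drop, hφB, zero_add, setIntegral_univ] at e
      rw [← e, map_measureReal_apply hY hBm, ← integral_indicator_one (hY hBm)]
      refine integral_congr_ae (.of_forall fun ω => ?_)
      have := futurePath_succ N d ω
      simp only [← this]
      rfl
    filter_upwards [h.condDistrib_ae_eq_blockMean hf hstat d k hBm hφ hφB] with ω hω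
    rw [hω, hP]
    exact h.abs_blockMean_drop_sub_integral_le hf hstat 1 d k hφ _
  -- countably many cylinder sets, hence one null set for all of them
  have hall := (ae_ball_iff (countable_cylinderAlgebra ℕ)).2 hcyl
  have hint : Integrable (fun ω => (κ₁ + κ₂) ^ d / (1 - κ₁) *
      ((lam 1 ω : ℝ) + ∫ ω, (lam 1 ω : ℝ) ∂P)) P :=
    (hlam.add (integrable_const _)).const_mul _
  calc betaCoeff P N (d + 1)
      ≤ ∫⁻ ω, ENNReal.ofReal ((κ₁ + κ₂) ^ d / (1 - κ₁) *
          ((lam 1 ω : ℝ) + ∫ ω, (lam 1 ω : ℝ) ∂P)) ∂P := by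
        refine lintegral_mono_ae ?_
        filter_upwards [hall] with ω hω
        refine iSup₂_le fun B hB => ENNReal.ofReal_le_ofReal ?_
        rw [← map_measureReal_apply hY hB]
        have : IsProbabilityMeasure (P.map (futurePath N (d + 1))) :=
          Measure.isProbabilityMeasure_map hY.aemeasurable
        exact abs_measureReal_sub_le_of_cylinderAlgebra _ _ hω hB
    _ = ENNReal.ofReal (∫ ω, (κ₁ + κ₂) ^ d / (1 - κ₁) *
          ((lam 1 ω : ℝ) + ∫ ω, (lam 1 ω : ℝ) ∂P) ∂P) :=
        (ofReal_integral_eq_lintegral_ofReal hint (.of_forall fun ω => mul_nonneg hC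
          (add_nonneg (NNReal.coe_nonneg _) (integral_nonneg fun ω => NNReal.coe_nonneg _)))).symm
    _ = _ := by
        congr 1
        rw [integral_const_mul, integral_add hlam (integrable_const _)]
        simp only [integral_const, probReal_univ, smul_eq_mul]
        ring

theorem IsPoissonCountProcess.isAbsolutelyRegular (h : IsPoissonCountProcess P f N lam)
    (hf : IsContractive f κ₁ κ₂)
    (hstat : IsStationaryProcess P (fun t ω => (N t ω, lam t ω))) :
    IsAbsolutelyRegular P N := by
  have hκ' : 0 ≤ κ₁ + κ₂ := add_nonneg hf.nonneg_fst hf.nonneg_snd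
  rw [IsAbsolutelyRegular, ← tendsto_add_atTop_iff_nat 1]
  refine tendsto_of_tendsto_of_tendsto_of_le_of_le tendsto_const_nhds ?_ (fun _ => zero_le)
    (fun d => h.betaCoeff_le hf hstat d)
  rw [← ENNReal.ofReal_zero]
  refine ENNReal.tendsto_ofReal ?_
  simpa using ((tendsto_pow_atTop_nhds_zero_of_lt_one hκ' hf.sum_lt_one).const_mul
    (2 * ∫ ω, (lam 1 ω : ℝ) ∂P)).div_const (1 - κ₁)

end AbsoluteRegularity

/-! ### Ergodicity -/

open scoped symmDiff in
/-- Mixing on cylinder sets implies ergodicity: an invariant set `s` is approximated by a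
cylinder set `C`, whose correlation with its own preimages is close to both `ν s` and
`(ν s) ^ 2`. -/
theorem MeasureTheory.MeasurePreserving.ergodic_of_tendsto_cylinder {ι : Type*}
    {ν : Measure (ι → ℕ)} [IsProbabilityMeasure ν] {T : (ι → ℕ) → ι → ℕ}
    (hT : MeasurePreserving T ν ν)
    (hmix : ∀ C ∈ cylinderAlgebra ι,
      Tendsto (fun r => ν.real (C ∩ T^[r] ⁻¹' C)) atTop (𝓝 (ν.real C ^ 2))) :
    Ergodic T ν := by
  refine ⟨hT, ⟨fun s hs hTs => ?_⟩⟩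
  have hiter : ∀ r, T^[r] ⁻¹' s = s := by
    intro r
    induction r with
    | zero => rfl
    | succ r ih => rw [Function.iterate_succ, Set.preimage_comp, ih, hTs]
  have hle1 : ∀ t, ν.real t ≤ 1 := fun t => measureReal_le_one
  have hkey : ∀ ε > 0, |ν.real s - ν.real s ^ 2| ≤ ε := by
    intro ε hε
    obtain ⟨C, hC, hlt⟩ := exists_cylinder_measure_symmDiff_lt ν hs
      (ENNReal.ofReal_pos.2 (show 0 < ε / 5 by positivity))
    have hCm := measurableSet_of_mem_cylinderAlgebra hC
    have hd : ν.real (C ∆ s) ≤ ε / 5 := ENNReal.toReal_le_of_le_ofReal (by positivity) hlt.le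
    obtain ⟨r, hr⟩ := ((hmix C hC).eventually (Metric.closedBall_mem_nhds _
      (show 0 < ε / 5 by positivity))).exists
    have hr' : |ν.real (C ∩ T^[r] ⁻¹' C) - ν.real C ^ 2| ≤ ε / 5 := hr
    have hTr := hT.iterate r
    have hCr : MeasurableSet (T^[r] ⁻¹' C) := hTr.measurable hCm
    have hd' : ν.real ((T^[r] ⁻¹' C) ∆ s) ≤ ε / 5 := by
      have : (T^[r] ⁻¹' C) ∆ s = T^[r] ⁻¹' (C ∆ s) := by
        rw [Set.preimage_symmDiff, hiter]
      rw [this, hTr.measureReal_preimage (hCm.symmDiff hs).nullMeasurableSet]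
      exact hd
    have h1 : |ν.real (C ∩ T^[r] ⁻¹' C) - ν.real s| ≤ 2 * (ε / 5) := by
      refine (abs_measureReal_sub_le_measureReal_symmDiff (hCm.inter hCr).nullMeasurableSet
        hs.nullMeasurableSet).trans ?_
      have hsub : (C ∩ T^[r] ⁻¹' C) ∆ s ⊆ C ∆ s ∪ (T^[r] ⁻¹' C) ∆ s := by
        intro x
        simp only [Set.mem_symmDiff, Set.mem_inter_iff, Set.mem_union]
        tauto
      have := (measureReal_mono (μ := ν) hsub).trans (measureReal_union_le _ _)
      linarith
    have h2 : |ν.real C - ν.real s| ≤ ε / 5 :=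
      (abs_measureReal_sub_le_measureReal_symmDiff hCm.nullMeasurableSet
        hs.nullMeasurableSet).trans hd
    have h3 : |ν.real C ^ 2 - ν.real s ^ 2| ≤ 2 * (ε / 5) := by
      have hfac : ν.real C ^ 2 - ν.real s ^ 2
          = (ν.real C + ν.real s) * (ν.real C - ν.real s) := by ring
      rw [hfac, abs_mul]
      refine mul_le_mul ?_ h2 (abs_nonneg _) zero_le_two
      rw [abs_of_nonneg (by positivity)]
      linarith [hle1 C, hle1 s]
    rw [abs_le] at *
    constructor <;> linarith
  have hsq : ν.real s - ν.real s ^ 2 = 0 :=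
    abs_nonpos_iff.1 (le_of_forall_pos_le_add fun ε hε => by simpa using hkey ε hε)
  have hcases : ν.real s = 0 ∨ ν.real s = 1 := by
    have : ν.real s * (1 - ν.real s) = 0 := by linarith [hsq, sq (ν.real s)]
    rcases mul_eq_zero.1 this with h | h
    · exact .inl h
    · exact .inr (by linarith)
  rw [eventuallyConst_set']
  rcases hcases with h | h
  · left
    rwa [ae_eq_empty, ← measureReal_eq_zero_iff]
  · right
    rw [ae_eq_univ, ← measureReal_eq_zero_iff, probReal_compl_eq_one_sub hs, h, sub_self]

theorem iterate_pathShift {S : Type*} (x : ℤ → S) (r : ℕ) :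
    (pathShift S)^[r] x = fun t => x (t + r) := by
  induction r generalizing x with
  | zero => simp
  | succ r ih =>
    rw [Function.iterate_succ_apply, ih]
    funext t
    simp only [pathShift]
    congr 1
    push_cast
    ring

theorem measurable_pathShift (S : Type*) [MeasurableSpace S] : Measurable (pathShift S) :=
  measurable_pi_lambda _ fun _ => measurable_pi_apply _

/-- The indicator of a cylinder set of two-sided sequences, as a function of the block of
coordinates in a window `[-m, m]`; shifting the sequence shifts the window. -/
theorem exists_window_functional {B : Set (ℤ → ℕ)} (hB : B ∈ cylinderAlgebra ℤ) :
    ∃ (m : ℕ) (φ : List ℕ → ℝ), (∀ s, φ s ∈ Set.Icc 0 1) ∧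
      ∀ (x : ℤ → ℕ) (r : ℤ),
        φ (pathSegment x (r - m - 1) (2 * m + 1)) = B.indicator 1 fun i => x (i + r) := by
  classical
  obtain ⟨I, hI⟩ := exists_finset_of_mem_cylinderAlgebra hB
  set m := I.sup Int.natAbs with hm
  refine ⟨m, fun s => B.indicator 1 fun i : ℤ => s.getD (i + m).toNat 0, fun s => ?_,
    fun x r => ?_⟩
  · exact ⟨Set.indicator_nonneg (fun _ _ => zero_le_one) _,
      Set.indicator_le' (fun _ _ => le_rfl) (fun _ _ => zero_le_one) _⟩
  · have := hI (fun i => (pathSegment x (r - m - 1) (2 * m + 1)).getD (i + m).toNat 0)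
      (fun i => x (i + r)) fun i hi => by
        have hle : i.natAbs ≤ m := Finset.le_sup (f := Int.natAbs) hi
        rw [pathSegment_getD x _ (by omega)]
        congr 1
        omega
    simp only [Set.indicator_apply, this, Pi.one_apply]

section Stationary

variable {Ω : Type*} [MeasurableSpace Ω] {P : Measure Ω}

theorem IsStationaryProcess.measurePreserving_pathShift {S : Type*} [MeasurableSpace S]
    {X : ℤ → Ω → S} (hX : ∀ t, Measurable (X t)) (hstat : IsStationaryProcess P X) :
    MeasurePreserving (pathShift S) (processLaw P X) (processLaw P X) := by
  refine ⟨measurable_pathShift S, ?_⟩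
  conv_rhs => rw [← hstat 1]
  rw [processLaw, processLaw, Measure.map_map (measurable_pathShift S) (measurable_pi_lambda _ hX)]
  rfl

theorem IsStationaryProcess.comp {S T : Type*} [MeasurableSpace S] [MeasurableSpace T]
    {X : ℤ → Ω → S} (hX : ∀ t, Measurable (X t)) (hstat : IsStationaryProcess P X) {u : S → T}
    (hu : Measurable u) : IsStationaryProcess P fun t ω => u (X t ω) := by
  have hU : Measurable fun (x : ℤ → S) t => u (x t) :=
    measurable_pi_lambda _ fun t => hu.comp (measurable_pi_apply t)
  have hmap : ∀ Y : ℤ → Ω → S, (∀ t, Measurable (Y t)) →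
      processLaw P (fun t ω => u (Y t ω)) = (processLaw P Y).map fun x t => u (x t) := by
    intro Y hY
    rw [processLaw, processLaw, Measure.map_map hU (measurable_pi_lambda _ hY)]
    rfl
  intro r
  rw [hmap _ fun t => hX (t + r), hmap X hX, hstat r]

end Stationary

section Ergodicity

variable {f : ℝ≥0 → ℕ → ℝ≥0} {κ₁ κ₂ : ℝ}
  {Ω : Type*} [MeasurableSpace Ω] {P : Measure Ω} {N : ℤ → Ω → ℕ} {lam : ℤ → Ω → ℝ≥0}
  [IsProbabilityMeasure P]

theorem IsPoissonCountProcess.tendsto_measureReal_inter_cylinder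
    (h : IsPoissonCountProcess P f N lam) (hf : IsContractive f κ₁ κ₂)
    (hstat : IsStationaryProcess P (fun t ω => (N t ω, lam t ω)))
    {C : Set (ℤ → ℕ)} (hC : C ∈ cylinderAlgebra ℤ) :
    Tendsto (fun r => (processLaw P N).real (C ∩ (pathShift ℕ)^[r] ⁻¹' C)) atTop
      (𝓝 ((processLaw P N).real C ^ 2)) := by
  have hκ' : 0 ≤ κ₁ + κ₂ := add_nonneg hf.nonneg_fst hf.nonneg_snd
  have hCm := measurableSet_of_mem_cylinderAlgebra hC
  have hN : Measurable fun ω t => N t ω := measurable_pi_lambda _ h.measurable_count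
  have hpres := (hstat.comp (u := Prod.fst)
    (fun t => (h.measurable_count t).prodMk (h.measurable_intensity t))
    measurable_fst).measurePreserving_pathShift h.measurable_count
  -- `C` depends on the window `[-m, m]`, its `r`-th preimage on `[r - m, r + m]`, which is `d`
  -- steps beyond the former for `r = d + (2 * m + 1)`
  obtain ⟨m, φ, hφ, hφC⟩ := exists_window_functional hC
  set A : Set Ω := (fun ω t => N t ω) ⁻¹' C with hA
  have hAhist : MeasurableSet[history N lam m] A := by
    have hmeas : Measurable[history N lam m]
        fun ω => φ (pathSegment (fun s => N s ω) (0 - m - 1) (2 * m + 1)) :=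
      @measurable_comp_pathSegment Ω (history N lam m) N _ _ (fun s _ hs =>
        measurable_history_count N lam (by push_cast at hs; omega)) φ
    have : A = (fun ω => φ (pathSegment (fun s => N s ω) (0 - m - 1) (2 * m + 1))) ⁻¹' {1} := by
      ext ω
      rw [Set.mem_preimage (a := ω) (s := {1}), hφC]
      by_cases hω : (fun t => N t ω) ∈ C <;> simp [hA, hω]
    rw [this]
    exact hmeas (measurableSet_singleton 1)
  have hAm : MeasurableSet A := hN hCm
  set a := (2 * ∫ ω, (lam ((m : ℤ) + 1) ω : ℝ) ∂P) / (1 - κ₁) with ha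
  have hbound : ∀ d : ℕ, |(processLaw P N).real (C ∩ (pathShift ℕ)^[d + (2 * m + 1)] ⁻¹' C)
      - (processLaw P N).real C ^ 2| ≤ a * (κ₁ + κ₂) ^ d := by
    intro d
    have hdec := h.abs_setIntegral_pathSegment_sub_le hf hstat m d (2 * m + 1) hφ hAhist
    set r := d + (2 * m + 1) with hr
    have ht : (m : ℤ) + d = (r : ℤ) - m - 1 := by rw [hr]; push_cast; ring
    have hDm : MeasurableSet ((pathShift ℕ)^[r] ⁻¹' C) := (hpres.iterate r).measurable hCm
    have hind : ∀ ω, φ (pathSegment (fun s => N s ω) (m + d) (2 * m + 1))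
        = ((fun ω t => N t ω) ⁻¹' ((pathShift ℕ)^[r] ⁻¹' C)).indicator 1 ω := by
      intro ω
      rw [ht, hφC]
      classical
      simp only [Set.indicator_apply, Set.mem_preimage, iterate_pathShift, Pi.one_apply]
    rw [funext hind] at hdec
    rw [integral_indicator_one (hN hDm), integral_indicator_one (hN hDm),
      measureReal_restrict_apply (hN hDm), Set.inter_comm, hA, ← Set.preimage_inter,
      ← map_measureReal_apply hN hDm, ← map_measureReal_apply hN hCm,
      ← map_measureReal_apply hN (hCm.inter hDm)] at hdec
    have hpre := (hpres.iterate r).measureReal_preimage hCm.nullMeasurableSet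
    rw [processLaw] at *
    rw [hpre, ← sq] at hdec
    refine hdec.trans_eq ?_
    rw [ha]
    ring
  rw [← tendsto_add_atTop_iff_nat (2 * m + 1), tendsto_iff_dist_tendsto_zero]
  refine squeeze_zero (fun _ => dist_nonneg) hbound ?_
  simpa using (tendsto_pow_atTop_nhds_zero_of_lt_one hκ' hf.sum_lt_one).const_mul a

theorem IsPoissonCountProcess.isErgodicProcess_count (h : IsPoissonCountProcess P f N lam)
    (hf : IsContractive f κ₁ κ₂)
    (hstat : IsStationaryProcess P (fun t ω => (N t ω, lam t ω))) :
    IsErgodicProcess P N := by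
  have : IsProbabilityMeasure (processLaw P N) :=
    Measure.isProbabilityMeasure_map (measurable_pi_lambda _ h.measurable_count).aemeasurable
  have hpres := (hstat.comp (u := Prod.fst)
    (fun t => (h.measurable_count t).prodMk (h.measurable_intensity t))
    measurable_fst).measurePreserving_pathShift h.measurable_count
  exact hpres.ergodic_of_tendsto_cylinder fun C hC =>
    h.tendsto_measureReal_inter_cylinder hf hstat hC

theorem IsPoissonCountProcess.isErgodicProcess (h : IsPoissonCountProcess P f N lam)
    (hf : IsContractive f κ₁ κ₂)
    (hstat : IsStationaryProcess P (fun t ω => (N t ω, lam t ω))) :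
    IsErgodicProcess P (fun t ω => (N t ω, lam t ω)) := by
  have hN : Measurable fun ω t => N t ω := measurable_pi_lambda _ h.measurable_count
  -- the bivariate process is a factor of the count process
  set Φ : (ℤ → ℕ) → ℤ → ℕ × ℝ≥0 :=
    fun x t => (x t, limitIntensity f fun k : ℕ => x (t - 1 - k)) with hΦ
  have hΦm : Measurable Φ := measurable_pi_lambda _ fun t => (measurable_pi_apply t).prodMk
    ((measurable_limitIntensity hf).comp (measurable_pi_lambda _ fun k => measurable_pi_apply _))
  have hmap : MeasurePreserving Φ (processLaw P N) (processLaw P fun t ω => (N t ω, lam t ω)) := by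
    refine ⟨hΦm, ?_⟩
    rw [processLaw, processLaw, Measure.map_map hΦm hN]
    refine Measure.map_congr ?_
    filter_upwards [ae_all_iff.2 (h.intensity_ae_eq_limitIntensity hf hstat)] with ω hω
    funext t
    simp only [hΦ, Function.comp_apply, ← hω t]
  refine hmap.ergodic_of_ergodic_semiconj (h.isErgodicProcess_count hf hstat)
    (measurable_pathShift _) fun x => ?_
  funext t
  simp only [hΦ, pathShift]
  congr 3
  funext k
  congr 1
  ring

end Ergodicity

theorem theorem3p1 {Ω : Type*} [MeasurableSpace Ω] (P : Measure Ω) [IsProbabilityMeasure P]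
    (f : ℝ≥0 → ℕ → ℝ≥0) (κ₁ κ₂ : ℝ) (hf : IsContractive f κ₁ κ₂)
    (N : ℤ → Ω → ℕ) (lam : ℤ → Ω → ℝ≥0)
    (hproc : IsPoissonCountProcess P f N lam)
    (hstat : IsStationaryProcess P (fun t ω => (N t ω, lam t ω))) :
    (IsAbsolutelyRegular P N ∧
      Integrable (fun ω => (lam 1 ω : ℝ)) P ∧
      ∀ n : ℕ, 1 ≤ n →
        betaCoeff P N n ≤
          ENNReal.ofReal (2 * (∫ ω, (lam 1 ω : ℝ) ∂P) * (κ₁ + κ₂) ^ (n - 1) / (1 - κ₁))) ∧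
    (∃ g : (ℕ → ℕ) → ℝ≥0, Measurable g ∧
      ∀ t : ℤ, ∀ᵐ ω ∂P, lam t ω = g (fun k => N (t - 1 - (k : ℤ)) ω)) ∧
    IsErgodicProcess P (fun t ω => (N t ω, lam t ω)) ∧
    Integrable (fun ω => (lam 1 ω : ℝ) ^ 2) P := by
  refine ⟨⟨hproc.isAbsolutelyRegular hf hstat, hproc.integrable_intensity hf hstat 1,
      fun n hn => ?_⟩,
    ⟨limitIntensity f, measurable_limitIntensity hf,
      hproc.intensity_ae_eq_limitIntensity hf hstat⟩,
    hproc.isErgodicProcess hf hstat, hproc.integrable_sq_intensity hf hstat 1⟩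
  obtain ⟨d, rfl⟩ := Nat.exists_eq_add_of_le' hn
  exact hproc.betaCoeff_le hf hstat d
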